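/- Let $H$ be a separable real Hilbert space and let $\gamma$ be a centered Gaussian measure on the Borel sets of $H$ with covariance operator $Q$, $\langle Qx,y\rangle_H=\int_H\langle x,z\rangle_H\langle y,z\rangle_H\,d\gamma(z)$ (which is self-adjoint, non-negative and trace class), and assume that $\gamma$ is non-degenerate, i.e. $\ker Q=\{0\}$. Let $H_{Q^{1/2}}=Q^{1/2}(H)$, a Hilbert space with inner product $\langle h,k\rangle_{H_{Q^{1/2}}}=\langle Q^{-1/2}h,Q^{-1/2}k\rangle_H$. Let $C^1_b(H)$ be the space of bounded, continuously Fréchet differentiable functions $\varphi:H\to\mathbb R$ with bounded derivative. The Gross gradient of $\varphi$ at $x$ is the element $\nabla_{H_{Q^{1/2}}}\varphi(x)\in H_{Q^{1/2}}$ such that $\varphi(x+h)-\varphi(x)-\langle\nabla_{H_{Q^{1/2}}}\varphi(x),h\rangle_{H_{Q^{1/2}}}=o(\|h\|_{H_{Q^{1/2}}})$ as $h\to0$ in $H_{Q^{1/2}}$. The Cannarsa--Da Prato gradient of $\varphi$ at $x$ is the element $\nabla_{Q^{1/2}}\varphi(x)\in H$ such that $\frac{\varphi(x+sQ^{1/2}v)-\varphi(x)}{s}\to\langle\nabla_{Q^{1/2}}\varphi(x),v\rangle_H$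 as $s\to0$ for every $v\in H$. Then: (1) For every $\varphi\in C^1_b(H)$ and $x\in H$ both gradients exist, $\nabla_{H_{Q^{1/2}}}\varphi(x)=Q^{1/2}\nabla_{Q^{1/2}}\varphi(x)$, and $\|\nabla_{H_{Q^{1/2}}}\varphi(x)\|_{H_{Q^{1/2}}}=\|\nabla_{Q^{1/2}}\varphi(x)\|_H$. (2) The operators $\nabla_{H_{Q^{1/2}}}:C^1_b(H)\subseteq L^2(H,\gamma)\to L^2(H,\gamma;H_{Q^{1/2}})$ and $\nabla_{Q^{1/2}}:C^1_b(H)\subseteq L^2(H,\gamma)\to L^2(H,\gamma;H)$ are well defined and closable. Denote their closures (the Malliavin derivatives in the sense of Gross and of Cannarsa--Da Prato) by $\nabla_{H_{Q^{1/2}}}$ and $M$, and the domains of the closures by $W^{1,2}_{H_{Q^{1/2}}}(H,\gamma)$ and $W^{1,2}_{Q^{1/2}}(H,\gamma)$. The two graph norms $(\|\varphi\|_{L^2(H,\gamma)}^2+\|\nabla_{H_{Q^{1/2}}}\varphi\|_{L^2(H,\gamma;H_{Q^{1/2}})}^2)^{1/2}$ and $(\|\varphi\|_{L^2(H,\gamma)}^2+\|M\varphi\|_{L^2(H,\gamma;H)}^2)^{1/2}$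 agree on $C^1_b(H)$. (3) The two Malliavin derivatives have the same domain, $W^{1,2}_{Q^{1/2}}(H,\gamma)=W^{1,2}_{H_{Q^{1/2}}}(H,\gamma)$, and on it $\nabla_{H_{Q^{1/2}}}=Q^{1/2}M$. (4) Regarded, through the embedding $H_{Q^{1/2}}\subseteq H$, as operators with values in $L^2(H,\gamma;H)$, the two Malliavin derivatives coincide if and only if $Q=\mathrm{Id}_H$; in particular they are different whenever $H$ is infinite-dimensional. -/

import Mathlib

open MeasureTheory ProbabilityTheory Filter Topology
open scoped RealInnerProductSpace

set_option linter.unusedSectionVars false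

noncomputable section

namespace Malliavin

/-! ### The square root of a positive operator on a real Hilbert space -/

section SquareRoot

/-- In a real Banach algebra, if `‖X‖ ≤ 1` then `Y = (X + Y ^ 2) / 2` has a solution in the closed
unit ball, which lies in every closed set that contains `0` and is stable under
`y ↦ (X + y ^ 2) / 2`. -/
theorem exists_quadratic_fixedPoint {A : Type*} [NormedRing A] [NormedAlgebra ℝ A]
    [CompleteSpace A] (X : A) (hX : ‖X‖ ≤ 1) :
    ∃ Y : A, ‖Y‖ ≤ 1 ∧ Y = (1 / 2 : ℝ) • (X + Y * Y) ∧
      ∀ C : Set A, IsClosed C → (0 : A) ∈ C → (∀ y ∈ C, (1 / 2 : ℝ) • (X + y * y) ∈ C) →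
        Y ∈ C := by
  let F : A → A := fun y => (1 / 2 : ℝ) • (X + y * y)
  let G : ℝ → ℝ := fun a => (1 / 2 : ℝ) * (1 + a * a)
  let y : ℕ → A := fun n => F^[n] 0
  let a : ℕ → ℝ := fun n => G^[n] 0
  have hy : ∀ n, y (n + 1) = (1 / 2 : ℝ) • (X + y n * y n) := fun n =>
    Function.iterate_succ_apply' F n 0
  have ha : ∀ n, a (n + 1) = (1 / 2 : ℝ) * (1 + a n * a n) := fun n =>
    Function.iterate_succ_apply' G n 0
  have ha01 : ∀ n, 0 ≤ a n ∧ a n ≤ 1 := by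
    intro n
    induction n with
    | zero => simp [a]
    | succ n ih =>
      rw [ha]
      constructor <;> nlinarith [ih.1, ih.2]
  have hya : ∀ n, ‖y n‖ ≤ a n := by
    intro n
    induction n with
    | zero => simp [a, y]
    | succ n ih =>
      rw [ha, hy, norm_smul]
      have h1 : ‖X + y n * y n‖ ≤ 1 + a n * a n :=
        (norm_add_le _ _).trans (add_le_add hX ((norm_mul_le _ _).trans
          (mul_le_mul ih ih (norm_nonneg _) (ha01 n).1)))
      have h2 : ‖(1 / 2 : ℝ)‖ = 1 / 2 := by norm_num
      rw [h2]
      linarith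
  have hd : ∀ n, ‖y (n + 1) - y n‖ ≤ a (n + 1) - a n := by
    intro n
    induction n with
    | zero =>
      have e1 : y 0 = 0 := rfl
      have e2 : a 0 = 0 := rfl
      rw [hy, ha, e1, e2, norm_sub_rev]
      simp only [mul_zero, add_zero, zero_sub, norm_neg, norm_smul]
      have h2 : ‖(1 / 2 : ℝ)‖ = 1 / 2 := by norm_num
      rw [h2]
      linarith
    | succ n ih =>
      have e : y (n + 1 + 1) - y (n + 1) = (1 / 2 : ℝ) •
          (y (n + 1) * (y (n + 1) - y n) + (y (n + 1) - y n) * y n) := by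
        rw [hy (n + 1)]
        nth_rewrite 3 [hy n]
        rw [← smul_sub]
        congr 1
        noncomm_ring
      have h2 : ‖(1 / 2 : ℝ)‖ = 1 / 2 := by norm_num
      rw [e, norm_smul, h2, ha (n + 1)]
      nth_rewrite 3 [ha n]
      have h3 : ‖y (n + 1) * (y (n + 1) - y n)‖ ≤ a (n + 1) * (a (n + 1) - a n) :=
        (norm_mul_le _ _).trans (mul_le_mul (hya _) ih (norm_nonneg _) (ha01 _).1)
      have h4 : ‖(y (n + 1) - y n) * y n‖ ≤ (a (n + 1) - a n) * a n :=
        (norm_mul_le _ _).trans (mul_le_mul ih (hya _) (norm_nonneg _)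
          ((norm_nonneg _).trans ih))
      have h5 := norm_add_le (y (n + 1) * (y (n + 1) - y n)) ((y (n + 1) - y n) * y n)
      nlinarith
  have hsum : Summable fun n => a (n + 1) - a n := by
    refine summable_of_sum_range_le (c := 1) (fun n => (norm_nonneg _).trans (hd n)) fun n => ?_
    rw [Finset.sum_range_sub]
    have e2 : a 0 = 0 := rfl
    rw [e2, sub_zero]
    exact (ha01 n).2
  have hcau : CauchySeq y := by
    refine cauchySeq_of_dist_le_of_summable (fun n => a (n + 1) - a n) (fun n => ?_) hsum
    rw [dist_comm, dist_eq_norm]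
    exact hd n
  obtain ⟨Y, hY⟩ := cauchySeq_tendsto_of_complete hcau
  refine ⟨Y, ?_, ?_, ?_⟩
  · exact le_of_tendsto hY.norm (Eventually.of_forall fun n => (hya n).trans (ha01 n).2)
  · have h1 : Tendsto (fun n => y (n + 1)) atTop (𝓝 Y) := hY.comp (tendsto_add_atTop_nat 1)
    have h2 : Tendsto (fun n => y (n + 1)) atTop (𝓝 ((1 / 2 : ℝ) • (X + Y * Y))) := by
      simp_rw [hy]
      exact ((hY.mul hY).const_add X).const_smul _
    exact tendsto_nhds_unique h1 h2
  · intro C hC h0 hst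
    refine hC.mem_of_tendsto hY (Eventually.of_forall fun n => ?_)
    induction n with
    | zero => exact h0
    | succ n ih => rw [hy]; exact hst _ ih

variable {H : Type*} [NormedAddCommGroup H] [InnerProductSpace ℝ H]

theorem norm_sq_le_of_isPositive {A : H →L[ℝ] H} (hA : A.IsPositive) {c : ℝ} (hc : 0 < c)
    (hAc : ‖A‖ ≤ c) (x : H) : ‖A x‖ ^ 2 ≤ c * ⟪A x, x⟫ := by
  have hs : ⟪A (A x), x⟫ = ‖A x‖ ^ 2 := by
    rw [hA.inner_left_eq_inner_right, real_inner_self_eq_norm_sq]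
  have h1 : 0 ≤ ⟪A (x - c⁻¹ • A x), x - c⁻¹ • A x⟫ := by
    have := hA.re_inner_nonneg_left (x - c⁻¹ • A x)
    simpa using this
  have h2 : ⟪A (A x), A x⟫ ≤ c * ‖A x‖ ^ 2 := by
    refine (real_inner_le_norm _ _).trans ?_
    have := A.le_opNorm (A x)
    nlinarith [norm_nonneg (A x), norm_nonneg (A (A x))]
  simp only [map_sub, map_smul, inner_sub_left, inner_sub_right, real_inner_smul_left,
    real_inner_smul_right, hs, real_inner_self_eq_norm_sq] at h1
  have hci : 0 < c⁻¹ := inv_pos.mpr hc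
  have h3 : c⁻¹ * (c⁻¹ * ⟪A (A x), A x⟫) ≤ c⁻¹ * ‖A x‖ ^ 2 := by
    refine mul_le_mul_of_nonneg_left ?_ hci.le
    rw [inv_mul_le_iff₀ hc]
    exact h2
  have h4 : c⁻¹ * ‖A x‖ ^ 2 ≤ ⟪A x, x⟫ := by linarith
  rwa [inv_mul_le_iff₀ hc] at h4

variable [CompleteSpace H]

theorem exists_sqrt (A : H →L[ℝ] H) (hA : A.IsPositive) :
    ∃ S : H →L[ℝ] H, (S.IsPositive ∧ S * S = A) ∧
      ∀ T : H →L[ℝ] H, T * A = A * T → T * S = S * T := by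
  set c : ℝ := ‖A‖ + 1 with hcdef
  have hc : 0 < c := by positivity
  have hAc : ‖A‖ ≤ c := by linarith
  set X : H →L[ℝ] H := 1 - c⁻¹ • A with hXdef
  have hX : ‖X‖ ≤ 1 := by
    refine ContinuousLinearMap.opNorm_le_bound _ zero_le_one fun x => ?_
    rw [one_mul]
    refine le_of_sq_le_sq ?_ (norm_nonneg _)
    have h := norm_sq_le_of_isPositive hA hc hAc x
    have e : X x = x - c⁻¹ • A x := by simp [hXdef]
    have hci : 0 < c⁻¹ := inv_pos.mpr hc
    rw [e, norm_sub_sq_real, norm_smul, real_inner_smul_right, real_inner_comm, Real.norm_eq_abs,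
      abs_of_pos hci]
    have h3 : (c⁻¹ * ‖A x‖) ^ 2 ≤ c⁻¹ * ⟪A x, x⟫ := by
      have : (c⁻¹ * ‖A x‖) ^ 2 = c⁻¹ * (c⁻¹ * ‖A x‖ ^ 2) := by ring
      rw [this]
      refine mul_le_mul_of_nonneg_left ?_ hci.le
      rwa [inv_mul_le_iff₀ hc]
    have h5 : 0 ≤ c⁻¹ * ⟪A x, x⟫ := (sq_nonneg _).trans h3
    linarith
  obtain ⟨Y, hY1, hYeq, hYC⟩ := exists_quadratic_fixedPoint X hX
  have hXsa : IsSelfAdjoint X := by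
    have h1 : IsSelfAdjoint (c⁻¹ • A) := (IsSelfAdjoint.all c⁻¹).smul hA.isSelfAdjoint
    exact (IsSelfAdjoint.one _).sub h1
  have hYsa : IsSelfAdjoint Y := by
    refine hYC {y | IsSelfAdjoint y} (isClosed_eq continuous_star continuous_id) (IsSelfAdjoint.zero _) ?_
    intro y hy
    have hyy : IsSelfAdjoint (y * y) := by
      rw [IsSelfAdjoint, star_mul, hy.star_eq]
    exact (IsSelfAdjoint.all (1 / 2 : ℝ)).smul (hXsa.add hyy)
  refine ⟨√c • (1 - Y), ⟨?_, ?_⟩, ?_⟩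
  · have hp : (1 - Y).IsPositive := by
      refine ContinuousLinearMap.isPositive_iff' _ |>.mpr ⟨(IsSelfAdjoint.one _).sub hYsa, ?_⟩
      intro x
      have h1 : ⟪Y x, x⟫ ≤ ‖x‖ * ‖x‖ := (real_inner_le_norm _ _).trans
        (mul_le_mul_of_nonneg_right ((Y.le_opNorm x).trans
          (mul_le_of_le_one_left (norm_nonneg _) hY1)) (norm_nonneg _))
      simp only [sub_apply,
        one_apply_eq_self, inner_sub_left, real_inner_self_eq_norm_mul_norm]
      simpa using h1
    exact hp.smul_of_nonneg (Real.sqrt_nonneg c)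
  · have h1 : (1 - Y) * (1 - Y) = c⁻¹ • A := by
      have h2 : (2 : ℝ) • Y = X + Y * Y := by
        conv_lhs => rw [hYeq]
        rw [smul_smul]; norm_num
      have h3 : (1 - Y) * (1 - Y) = 1 - (2 : ℝ) • Y + Y * Y := by
        rw [two_smul]; noncomm_ring
      rw [h3, h2, hXdef]; abel
    rw [smul_mul_smul_comm, h1, Real.mul_self_sqrt hc.le, smul_smul, mul_inv_cancel₀ hc.ne',
      one_smul]
  · intro T hT
    have hTX : T * X = X * T := by
      simp [hXdef, mul_sub, sub_mul, hT]
    have hTY : T * Y = Y * T := by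
      refine hYC {y | T * y = y * T} (isClosed_eq (by fun_prop) (by fun_prop)) (by simp) ?_
      intro y hy
      have hy' : T * y = y * T := hy
      change T * ((1 / 2 : ℝ) • (X + y * y)) = ((1 / 2 : ℝ) • (X + y * y)) * T
      rw [mul_smul_comm, smul_mul_assoc, mul_add, add_mul, hTX, ← mul_assoc, hy', mul_assoc, hy',
        ← mul_assoc]
    rw [mul_smul_comm, smul_mul_assoc, mul_sub, sub_mul, hTY, mul_one, one_mul]

/-- A positive operator on a real Hilbert space has exactly one positive square root. -/
theorem existsUnique_sqrt (A : H →L[ℝ] H) (hA : A.IsPositive) :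
    ∃! S : H →L[ℝ] H, S.IsPositive ∧ S * S = A := by
  obtain ⟨S, ⟨hS, hSA⟩, hcomm⟩ := exists_sqrt A hA
  refine ⟨S, ⟨hS, hSA⟩, ?_⟩
  rintro T ⟨hT, hTA⟩
  have hTS : T * S = S * T := hcomm T (by rw [← hTA, mul_assoc])
  have key : ∀ B : H →L[ℝ] H, B.IsPositive → ∀ y, ⟪B y, y⟫ = 0 → B y = 0 := by
    intro B hB y h
    have h1 := norm_sq_le_of_isPositive hB (c := ‖B‖ + 1) (by positivity) (by linarith) y
    rw [h, mul_zero] at h1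
    have h2 : ‖B y‖ ^ 2 = 0 := le_antisymm h1 (sq_nonneg _)
    simpa using h2
  have hD : ∀ x, (T - S) x = 0 := by
    intro x
    set y := (T - S) x with hy
    have h0 : T y + S y = 0 := by
      have : (T + S) * (T - S) = 0 := by
        rw [add_mul, mul_sub, mul_sub, hTA, hSA, hTS]; abel
      have := congrArg (fun B : H →L[ℝ] H => B x) this
      simpa [hy] using this
    have h1 : ⟪T y, y⟫ + ⟪S y, y⟫ = 0 := by rw [← inner_add_left, h0, inner_zero_left]
    have hTp : 0 ≤ ⟪T y, y⟫ := by simpa using hT.re_inner_nonneg_left y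
    have hSp : 0 ≤ ⟪S y, y⟫ := by simpa using hS.re_inner_nonneg_left y
    have hTy := key T hT y (by linarith)
    have hSy := key S hS y (by linarith)
    have h2 : ⟪y, y⟫ = 0 := by
      have : ⟪(T - S) x, y⟫ = ⟪x, (T - S) y⟫ := by
        simp only [sub_apply, inner_sub_left, inner_sub_right,
          hT.inner_left_eq_inner_right, hS.inner_left_eq_inner_right]
      rw [← hy, sub_apply, hTy, hSy, sub_zero, inner_zero_right] at this
      exact this
    exact inner_self_eq_zero.mp h2
  ext x
  have := hD x
  rw [sub_apply, sub_eq_zero] at this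
  exact this

open Classical in
/-- The square root `A^{1/2}`: the unique positive operator whose square is the positive operator
`A` (and `0` if `A` is not positive). -/
def opSqrt (A : H →L[ℝ] H) : H →L[ℝ] H :=
  if hA : A.IsPositive then (existsUnique_sqrt A hA).choose else 0

theorem opSqrt_spec {A : H →L[ℝ] H} (hA : A.IsPositive) :
    (opSqrt A).IsPositive ∧ opSqrt A * opSqrt A = A := by
  rw [opSqrt, dif_pos hA]
  exact (existsUnique_sqrt A hA).choose_spec.1

end SquareRoot

/-! ### The Hilbert space `H_R = R(H)` -/

section RangeSpace

variable {H : Type*} [NormedAddCommGroup H] [InnerProductSpace ℝ H]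

/-- The space `H_R = R(H)`, the range of `R`; it carries its own inner product (defined below), not
the one inherited from `H`. -/
def RangeSpace (R : H →L[ℝ] H) : Type _ := LinearMap.range (R : H →ₗ[ℝ] H)

namespace RangeSpace

variable (R : H →L[ℝ] H)

instance : AddCommGroup (RangeSpace R) :=
  inferInstanceAs (AddCommGroup (LinearMap.range (R : H →ₗ[ℝ] H)))

instance : Module ℝ (RangeSpace R) :=
  inferInstanceAs (Module ℝ (LinearMap.range (R : H →ₗ[ℝ] H)))

/-- The inclusion of `H_R` into `H` as a linear map. -/
def inclₗ : RangeSpace R →ₗ[ℝ] H := (LinearMap.range (R : H →ₗ[ℝ] H)).subtype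

theorem inclₗ_injective : Function.Injective (inclₗ R) := Subtype.val_injective

/-- `v ↦ R v` as a linear map from `H` to `H_R`. -/
def ofVecₗ : H →ₗ[ℝ] RangeSpace R := (R : H →ₗ[ℝ] H).rangeRestrict

@[simp] theorem inclₗ_ofVecₗ (v : H) : inclₗ R (ofVecₗ R v) = R v := rfl

variable [CompleteSpace H]

instance : CompleteSpace (LinearMap.ker (R : H →ₗ[ℝ] H)) :=
  (ContinuousLinearMap.isClosed_ker R).completeSpace_coe

/-- The restriction of `R` to `(ker R)ᗮ`, a linear bijection onto `H_R`. -/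
def equivKerOrtho : (LinearMap.ker (R : H →ₗ[ℝ] H))ᗮ ≃ₗ[ℝ] RangeSpace R :=
  LinearEquiv.ofBijective ((ofVecₗ R).comp (LinearMap.ker (R : H →ₗ[ℝ] H))ᗮ.subtype) <| by
    constructor
    · rw [← LinearMap.ker_eq_bot, LinearMap.ker_eq_bot']
      intro m hm
      have h1 : R (m : H) = 0 := congrArg (inclₗ R) hm
      have h2 : (m : H) ∈ LinearMap.ker (R : H →ₗ[ℝ] H) := h1
      have h3 : ⟪(m : H), (m : H)⟫ = 0 := m.2 _ h2
      exact Subtype.ext (inner_self_eq_zero.mp h3)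
    · rintro ⟨_, v, rfl⟩
      set K := LinearMap.ker (R : H →ₗ[ℝ] H)
      refine ⟨⟨v - K.starProjection v, K.sub_starProjection_mem_orthogonal v⟩, ?_⟩
      have h : R (K.starProjection v) = 0 := (K.starProjection_apply_mem v : _ ∈ K)
      apply inclₗ_injective R
      change R (v - K.starProjection v) = R v
      rw [map_sub, h, sub_zero]

/-- The pseudo-inverse `R⁻¹ : H_R → (ker R)ᗮ ⊆ H`, the inverse of the restriction of `R` to
`(ker R)ᗮ`. -/
def pinv : RangeSpace R →ₗ[ℝ] H :=
  (LinearMap.ker (R : H →ₗ[ℝ] H))ᗮ.subtype.comp (equivKerOrtho R).symm.toLinearMap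

theorem pinv_mem (h : RangeSpace R) : pinv R h ∈ (LinearMap.ker (R : H →ₗ[ℝ] H))ᗮ :=
  ((equivKerOrtho R).symm h).2

/-- `R R⁻¹ = id` on `H_R`. -/
theorem apply_pinv (h : RangeSpace R) : R (pinv R h) = inclₗ R h :=
  congrArg (inclₗ R) ((equivKerOrtho R).apply_symm_apply h)

theorem pinv_injective : Function.Injective (pinv R) :=
  Subtype.val_injective.comp (equivKerOrtho R).symm.injective

/-- The inner product of `H_R`: `⟪h, k⟫_{H_R} = ⟪R⁻¹ h, R⁻¹ k⟫_H`. -/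
abbrev core : InnerProductSpace.Core ℝ (RangeSpace R) where
  inner h k := ⟪pinv R h, pinv R k⟫
  conj_inner_symm h k := by simp [real_inner_comm]
  re_inner_nonneg h := by simp
  add_left h k l := by simp [inner_add_left]
  smul_left h k r := by simp [real_inner_smul_left]
  definite h hh := by
    have h1 : pinv R h = 0 := inner_self_eq_zero.mp hh
    exact pinv_injective R (by rw [h1, map_zero])

instance : NormedAddCommGroup (RangeSpace R) := (core R).toNormedAddCommGroup

instance : InnerProductSpace ℝ (RangeSpace R) := InnerProductSpace.ofCore (core R).toCore

theorem inner_def (h k : RangeSpace R) : ⟪h, k⟫ = ⟪pinv R h, pinv R k⟫ := rfl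

theorem norm_def (h : RangeSpace R) : ‖h‖ = ‖pinv R h‖ := by
  rw [@norm_eq_sqrt_real_inner (RangeSpace R), @norm_eq_sqrt_real_inner H, inner_def]

/-- `R` restricts to a linear isometry from `(ker R)ᗮ` onto `H_R`. -/
def isometryKerOrtho : RangeSpace R ≃ₗᵢ[ℝ] (LinearMap.ker (R : H →ₗ[ℝ] H))ᗮ :=
  { (equivKerOrtho R).symm with
    norm_map' := fun h => (norm_def R h).symm }

instance : CompleteSpace (RangeSpace R) :=
  (isometryKerOrtho R).isometry.isUniformInducing.completeSpace_congr
    (isometryKerOrtho R).surjective |>.mpr inferInstance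

/-- The continuous embedding of `H_R` into `H`. -/
def incl : RangeSpace R →L[ℝ] H :=
  (inclₗ R).mkContinuous ‖R‖ fun h => by
    rw [← apply_pinv, norm_def]
    exact R.le_opNorm _

theorem norm_ofVecₗ_le (v : H) : ‖ofVecₗ R v‖ ≤ 1 * ‖v‖ := by
  set w := pinv R (ofVecₗ R v) with hw
  have h1 : v - w ∈ LinearMap.ker (R : H →ₗ[ℝ] H) := by
    change R (v - w) = 0
    rw [map_sub, hw, apply_pinv, inclₗ_ofVecₗ, sub_self]
  have h2 : ⟪v - w, w⟫ = 0 := pinv_mem R (ofVecₗ R v) _ h1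
  rw [norm_def, ← hw, one_mul]
  have h3 : ⟪v, w⟫ = ‖w‖ * ‖w‖ := by
    rw [inner_sub_left, real_inner_self_eq_norm_mul_norm] at h2
    linarith
  have h4 := real_inner_le_norm v w
  rw [h3] at h4
  rcases (norm_nonneg w).eq_or_lt with h5 | h5
  · rw [← h5]; exact norm_nonneg v
  · exact le_of_mul_le_mul_right h4 h5

/-- `v ↦ R v` as a continuous linear map from `H` onto the Hilbert space `H_R`. -/
def ofVec : H →L[ℝ] RangeSpace R := (ofVecₗ R).mkContinuous 1 (norm_ofVecₗ_le R)

@[simp] theorem incl_ofVec (v : H) : incl R (ofVec R v) = R v := rfl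

end RangeSpace

end RangeSpace

/-! ### Differentiability along a subspace -/

section Differentiability

variable {H : Type*} [NormedAddCommGroup H] [InnerProductSpace ℝ H] [CompleteSpace H]

/-- `l` is the Gross gradient of `f` at `x` along `H_R`: `l ∈ H_R` and
`f (x + h) - f x - ⟪l, h⟫_{H_R} = o(‖h‖_{H_R})` as `h → 0` in `H_R`. -/
def HasGrossGradientAt (R : H →L[ℝ] H) (f : H → ℝ) (l : RangeSpace R) (x : H) : Prop :=
  HasGradientAt (fun h : RangeSpace R => f (x + RangeSpace.incl R h)) l 0

/-- The Gross gradient `∇_{H_R} f (x)` (`0` where `f` is not `H_R`-Fréchet differentiable). -/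
def grossGradient (R : H →L[ℝ] H) (f : H → ℝ) (x : H) : RangeSpace R :=
  gradient (fun h : RangeSpace R => f (x + RangeSpace.incl R h)) 0

theorem HasGrossGradientAt.grossGradient {R : H →L[ℝ] H} {f : H → ℝ} {l : RangeSpace R} {x : H}
    (h : HasGrossGradientAt R f l x) : grossGradient R f x = l :=
  HasGradientAt.gradient h

/-- `l` is the Cannarsa--Da Prato gradient of `f` at `x`: `l ∈ H` and, for every `v ∈ H`,
`(f (x + s R v) - f x) / s → ⟪l, v⟫_H` as `s → 0`. -/
def HasRGradientAt (R : H →L[ℝ] H) (f : H → ℝ) (l : H) (x : H) : Prop :=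
  ∀ v : H, Tendsto (fun s : ℝ => |(f (x + s • R v) - f x) / s - ⟪l, v⟫|) (𝓝[≠] 0) (𝓝 0)

open Classical in
/-- The Cannarsa--Da Prato gradient `∇_R f (x)` (`0` where `f` is not `R`-differentiable). -/
def rGradient (R : H →L[ℝ] H) (f : H → ℝ) (x : H) : H :=
  if h : ∃ l, HasRGradientAt R f l x then h.choose else 0

theorem HasRGradientAt.tendsto {R : H →L[ℝ] H} {f : H → ℝ} {l x : H}
    (h : HasRGradientAt R f l x) (v : H) :
    Tendsto (fun s : ℝ => (f (x + s • R v) - f x) / s) (𝓝[≠] 0) (𝓝 ⟪l, v⟫) := by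
  have h1 := (tendsto_zero_iff_abs_tendsto_zero _).mpr (h v)
  simpa using h1.add_const ⟪l, v⟫

theorem hasRGradientAt_of_tendsto {R : H →L[ℝ] H} {f : H → ℝ} {l x : H}
    (h : ∀ v, Tendsto (fun s : ℝ => (f (x + s • R v) - f x) / s) (𝓝[≠] 0) (𝓝 ⟪l, v⟫)) :
    HasRGradientAt R f l x := fun v => by
  refine (tendsto_zero_iff_abs_tendsto_zero _).mp ?_
  simpa using (h v).sub_const ⟪l, v⟫

theorem HasRGradientAt.rGradient {R : H →L[ℝ] H} {f : H → ℝ} {l x : H}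
    (h : HasRGradientAt R f l x) : rGradient R f x = l := by
  have hex : ∃ l, HasRGradientAt R f l x := ⟨l, h⟩
  rw [Malliavin.rGradient, dif_pos hex]
  refine ext_inner_right ℝ fun v => ?_
  exact tendsto_nhds_unique (hex.choose_spec.tendsto v) (h.tendsto v)

/-- The space `C^1_b(H)`: bounded, continuously Fréchet differentiable functions `H → ℝ` with
bounded derivative. -/
structure IsCb1 (f : H → ℝ) : Prop where
  contDiff : ContDiff ℝ 1 f
  bounded : ∃ C, ∀ x, |f x| ≤ C
  bounded_fderiv : ∃ C, ∀ x, ‖fderiv ℝ f x‖ ≤ C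

theorem IsCb1.zero : IsCb1 (0 : H → ℝ) :=
  ⟨contDiff_const, ⟨0, fun x => by simp⟩, ⟨0, fun x => by simp⟩⟩

theorem IsCb1.add {f g : H → ℝ} (hf : IsCb1 f) (hg : IsCb1 g) : IsCb1 (f + g) := by
  obtain ⟨C, hC⟩ := hf.bounded
  obtain ⟨D, hD⟩ := hg.bounded
  obtain ⟨C', hC'⟩ := hf.bounded_fderiv
  obtain ⟨D', hD'⟩ := hg.bounded_fderiv
  refine ⟨hf.contDiff.add hg.contDiff, ⟨C + D, fun x => ?_⟩, ⟨C' + D', fun x => ?_⟩⟩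
  · exact (abs_add_le _ _).trans (add_le_add (hC x) (hD x))
  · rw [fderiv_add (hf.contDiff.differentiable one_ne_zero x)
      (hg.contDiff.differentiable one_ne_zero x)]
    exact (norm_add_le _ _).trans (add_le_add (hC' x) (hD' x))

theorem IsCb1.const_smul {f : H → ℝ} (c : ℝ) (hf : IsCb1 f) : IsCb1 (c • f) := by
  obtain ⟨C, hC⟩ := hf.bounded
  obtain ⟨C', hC'⟩ := hf.bounded_fderiv
  refine ⟨hf.contDiff.const_smul c, ⟨|c| * C, fun x => ?_⟩, ⟨|c| * C', fun x => ?_⟩⟩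
  · simpa [abs_mul] using mul_le_mul_of_nonneg_left (hC x) (abs_nonneg c)
  · rw [fderiv_const_smul (hf.contDiff.differentiable one_ne_zero x), norm_smul]
    exact mul_le_mul_of_nonneg_left (hC' x) (abs_nonneg c)

theorem IsCb1.hasGrossGradientAt (R : H →L[ℝ] H) {f : H → ℝ} (hf : IsCb1 f) (x : H) :
    HasGrossGradientAt R f (grossGradient R f x) x := by
  refine DifferentiableAt.hasGradientAt ?_
  have h1 : Differentiable ℝ f := hf.contDiff.differentiable one_ne_zero
  exact (h1.comp ((RangeSpace.incl R).differentiable.const_add x)).differentiableAt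

theorem IsCb1.hasRGradientAt (R : H →L[ℝ] H) {f : H → ℝ} (hf : IsCb1 f) (x : H) :
    HasRGradientAt R f (rGradient R f x) x := by
  have hd : DifferentiableAt ℝ f x := hf.contDiff.differentiable one_ne_zero x
  have hex : ∃ l, HasRGradientAt R f l x := by
    refine ⟨(R.adjoint) (gradient f x), hasRGradientAt_of_tendsto fun v => ?_⟩
    rw [ContinuousLinearMap.adjoint_inner_left]
    have h1 := (hd.hasGradientAt.hasFDerivAt.hasLineDerivAt (R v)).tendsto_slope_zero
    simpa [InnerProductSpace.toDual_apply_apply, div_eq_inv_mul] using h1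
  rw [Malliavin.rGradient, dif_pos hex]
  exact hex.choose_spec

theorem grossGradient_zero (R : H →L[ℝ] H) (x : H) : grossGradient R (0 : H → ℝ) x = 0 :=
  HasGrossGradientAt.grossGradient (hasGradientAt_const 0 (0 : ℝ))

theorem grossGradient_add (R : H →L[ℝ] H) {f g : H → ℝ} (hf : IsCb1 f) (hg : IsCb1 g) (x : H) :
    grossGradient R (f + g) x = grossGradient R f x + grossGradient R g x := by
  refine HasGrossGradientAt.grossGradient ?_
  have h1 := (hf.hasGrossGradientAt R x).hasFDerivAt.add (hg.hasGrossGradientAt R x).hasFDerivAt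
  rw [HasGrossGradientAt, hasGradientAt_iff_hasFDerivAt, map_add]
  exact h1

theorem grossGradient_smul (R : H →L[ℝ] H) {f : H → ℝ} (c : ℝ) (hf : IsCb1 f) (x : H) :
    grossGradient R (c • f) x = c • grossGradient R f x := by
  refine HasGrossGradientAt.grossGradient ?_
  have h1 := (hf.hasGrossGradientAt R x).hasFDerivAt.const_smul c
  rw [HasGrossGradientAt, hasGradientAt_iff_hasFDerivAt, map_smulₛₗ]
  exact h1

theorem rGradient_zero (R : H →L[ℝ] H) (x : H) : rGradient R (0 : H → ℝ) x = 0 :=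
  HasRGradientAt.rGradient (hasRGradientAt_of_tendsto fun v => by simp)

theorem rGradient_add (R : H →L[ℝ] H) {f g : H → ℝ} (hf : IsCb1 f) (hg : IsCb1 g) (x : H) :
    rGradient R (f + g) x = rGradient R f x + rGradient R g x := by
  refine HasRGradientAt.rGradient (hasRGradientAt_of_tendsto fun v => ?_)
  rw [inner_add_left]
  refine (((hf.hasRGradientAt R x).tendsto v).add ((hg.hasRGradientAt R x).tendsto v)).congr
    fun s => ?_
  simp only [Pi.add_apply]
  ring

theorem rGradient_smul (R : H →L[ℝ] H) {f : H → ℝ} (c : ℝ) (hf : IsCb1 f) (x : H) :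
    rGradient R (c • f) x = c • rGradient R f x := by
  refine HasRGradientAt.rGradient (hasRGradientAt_of_tendsto fun v => ?_)
  rw [real_inner_smul_left]
  refine (((hf.hasRGradientAt R x).tendsto v).const_mul c).congr fun s => ?_
  simp only [Pi.smul_apply, smul_eq_mul]
  ring

end Differentiability

/-! ### Malliavin derivatives and Sobolev spaces -/

section Sobolev

variable {H : Type*} [NormedAddCommGroup H] [InnerProductSpace ℝ H] [CompleteSpace H]
  [MeasurableSpace H]

/-- The graph `{([φ], [∇_{H_R} φ]) | φ ∈ C^1_b(H)}` in `L²(H, γ) × L²(H, γ; H_R)`. -/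
def grossGraph (R : H →L[ℝ] H) (γ : Measure H) :
    Submodule ℝ (Lp ℝ 2 γ × Lp (RangeSpace R) 2 γ) where
  carrier := {p | ∃ φ : H → ℝ, IsCb1 φ ∧ p.1 =ᵐ[γ] φ ∧ p.2 =ᵐ[γ] grossGradient R φ}
  zero_mem' := by
    refine ⟨0, IsCb1.zero, Lp.coeFn_zero _ _ _, ?_⟩
    filter_upwards [Lp.coeFn_zero (RangeSpace R) 2 γ] with x hx
    rw [grossGradient_zero]
    exact hx
  add_mem' := by
    rintro ⟨a, a'⟩ ⟨b, b'⟩ ⟨φ, hφ, h1, h2⟩ ⟨ψ, hψ, h3, h4⟩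
    refine ⟨φ + ψ, hφ.add hψ, (Lp.coeFn_add a b).trans (h1.add h3), ?_⟩
    filter_upwards [Lp.coeFn_add a' b', h2, h4] with x hx hx2 hx4
    rw [grossGradient_add R hφ hψ]
    rw [← hx2, ← hx4]
    exact hx
  smul_mem' := by
    rintro c ⟨a, a'⟩ ⟨φ, hφ, h1, h2⟩
    refine ⟨c • φ, hφ.const_smul c, (Lp.coeFn_smul c a).trans (h1.const_smul c), ?_⟩
    filter_upwards [Lp.coeFn_smul c a', h2] with x hx hx2
    rw [grossGradient_smul R c hφ]
    rw [← hx2]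
    exact hx

/-- The graph `{([φ], [∇_R φ]) | φ ∈ C^1_b(H)}` in `L²(H, γ) × L²(H, γ; H)`. -/
def rGraph (R : H →L[ℝ] H) (γ : Measure H) : Submodule ℝ (Lp ℝ 2 γ × Lp H 2 γ) where
  carrier := {p | ∃ φ : H → ℝ, IsCb1 φ ∧ p.1 =ᵐ[γ] φ ∧ p.2 =ᵐ[γ] rGradient R φ}
  zero_mem' := by
    refine ⟨0, IsCb1.zero, Lp.coeFn_zero _ _ _, ?_⟩
    filter_upwards [Lp.coeFn_zero H 2 γ] with x hx
    rw [rGradient_zero]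
    exact hx
  add_mem' := by
    rintro ⟨a, a'⟩ ⟨b, b'⟩ ⟨φ, hφ, h1, h2⟩ ⟨ψ, hψ, h3, h4⟩
    refine ⟨φ + ψ, hφ.add hψ, (Lp.coeFn_add a b).trans (h1.add h3), ?_⟩
    filter_upwards [Lp.coeFn_add a' b', h2, h4] with x hx hx2 hx4
    rw [rGradient_add R hφ hψ]
    rw [← hx2, ← hx4]
    exact hx
  smul_mem' := by
    rintro c ⟨a, a'⟩ ⟨φ, hφ, h1, h2⟩
    refine ⟨c • φ, hφ.const_smul c, (Lp.coeFn_smul c a).trans (h1.const_smul c), ?_⟩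
    filter_upwards [Lp.coeFn_smul c a', h2] with x hx hx2
    rw [rGradient_smul R c hφ]
    rw [← hx2]
    exact hx

/-- The operator `∇_{H_R} : C^1_b(H) ⊆ L²(H, γ) → L²(H, γ; H_R)`. -/
def grossOp (R : H →L[ℝ] H) (γ : Measure H) : Lp ℝ 2 γ →ₗ.[ℝ] Lp (RangeSpace R) 2 γ :=
  (grossGraph R γ).toLinearPMap

/-- The operator `∇_R : C^1_b(H) ⊆ L²(H, γ) → L²(H, γ; H)`. -/
def rOp (R : H →L[ℝ] H) (γ : Measure H) : Lp ℝ 2 γ →ₗ.[ℝ] Lp H 2 γ :=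
  (rGraph R γ).toLinearPMap

variable [BorelSpace H]

/-- `Q^{1/2}`, where `Q` is the covariance operator of the centered measure `γ`,
`⟪Q x, y⟫ = ∫ z, ⟪x, z⟫ * ⟪y, z⟫ ∂γ`. -/
def sqrtCov (γ : Measure H) : H →L[ℝ] H := opSqrt (covarianceOperator γ)

/-- The Malliavin derivative in the sense of Gross: the closure of `∇_{H_{Q^{1/2}}}`. -/
def grossMalliavin (γ : Measure H) : Lp ℝ 2 γ →ₗ.[ℝ] Lp (RangeSpace (sqrtCov γ)) 2 γ :=
  (grossOp (sqrtCov γ) γ).closure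

/-- The Malliavin derivative `M` in the sense of Cannarsa--Da Prato: the closure of
`∇_{Q^{1/2}}`. -/
def malliavinM (γ : Measure H) : Lp ℝ 2 γ →ₗ.[ℝ] Lp H 2 γ :=
  (rOp (sqrtCov γ) γ).closure

/-- The Sobolev space `W^{1,2}_{H_{Q^{1/2}}}(H, γ)`. -/
def sobolevGross (γ : Measure H) : Submodule ℝ (Lp ℝ 2 γ) := (grossMalliavin γ).domain

/-- The Sobolev space `W^{1,2}_{Q^{1/2}}(H, γ)`. -/
def sobolevM (γ : Measure H) : Submodule ℝ (Lp ℝ 2 γ) := (malliavinM γ).domain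

end Sobolev

/-- The graph norm `(‖f‖² + ‖D f‖²)^{1/2}` of an unbounded operator `D`. -/
def graphNorm {E F : Type*} [NormedAddCommGroup E] [NormedSpace ℝ E] [NormedAddCommGroup F]
    [NormedSpace ℝ F] (D : E →ₗ.[ℝ] F) (f : D.domain) : ℝ :=
  √(‖(f : E)‖ ^ 2 + ‖D f‖ ^ 2)

end Malliavin

end

namespace Malliavin

/-! ### Gradients of test functions and of plane waves. -/

section TestFunctions

variable {H : Type*} [NormedAddCommGroup H] [InnerProductSpace ℝ H] [CompleteSpace H]

/-! Write `R = Q^{1/2}`, which is self-adjoint, and injective because `Q` is. The chain rule gives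
`∇_R φ = R ∇φ`. Since `Dφ(x) h = ⟪R ∇φ(x), R⁻¹ h⟫` for `h` in `H_R`, the Gross gradient is `R (∇_R
φ)`. As `R` is an isometry of `H` onto `H_R`, composition with it carries the graph of `∇_R` onto
that of the Gross gradient, and one closure onto the other. Equality of domains, `∇_{H_R} = R M` and
equality of graph norms all follow (`mem_closure_grossGraph_iff`, `grossMalliavin_eq`), so only
`∇_R` has to be shown closable.

Closability comes from integration by parts, `∫ Dφ(Qk) = ∫ φ ⟪k, x⟫`, the derivative at angle zero
of the rotation invariance of `γ ⊗ γ`. Applied to `φψ`, it moves the derivative onto `ψ`. The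
resulting identity is continuous in `L²` and so survives on the closure of the graph. If the
function component vanishes, taking cosines and sines for `ψ` kills the Fourier transform of every
component of `R` applied to the gradient component, which is therefore zero.

For the last claim, if `R M = M`, the gradients of `cos ⟪a, x⟫` and `sin ⟪a, x⟫`, multiples of `R
a`, force `R a = a`. Finally `Q = Id` contradicts `∫ ‖x‖² < ∞` in infinite dimension. -/

theorem IsCb1.differentiable {f : H → ℝ} (hf : IsCb1 f) : Differentiable ℝ f :=
  hf.contDiff.differentiable one_ne_zero

theorem IsCb1.continuous {f : H → ℝ} (hf : IsCb1 f) : Continuous f :=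
  hf.contDiff.continuous

theorem IsCb1.continuous_fderiv {f : H → ℝ} (hf : IsCb1 f) : Continuous (fderiv ℝ f) :=
  hf.contDiff.continuous_fderiv one_ne_zero

/-- Needed to put a product `φψ` into the integration by parts formula. -/
theorem IsCb1.mul {f g : H → ℝ} (hf : IsCb1 f) (hg : IsCb1 g) :
    IsCb1 (fun x => f x * g x) := by
  obtain ⟨C, hC⟩ := hf.bounded
  obtain ⟨D, hD⟩ := hg.bounded
  obtain ⟨C', hC'⟩ := hf.bounded_fderiv
  obtain ⟨D', hD'⟩ := hg.bounded_fderiv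
  refine ⟨hf.contDiff.mul hg.contDiff, ⟨C * D, fun x => ?_⟩, ⟨C * D' + D * C', fun x => ?_⟩⟩
  · rw [abs_mul]
    exact mul_le_mul (hC x) (hD x) (abs_nonneg _) ((abs_nonneg _).trans (hC x))
  · rw [fderiv_fun_mul (hf.differentiable x) (hg.differentiable x)]
    refine (norm_add_le _ _).trans (add_le_add ?_ ?_)
    · rw [norm_smul]
      exact mul_le_mul (hC x) (hD' x) (norm_nonneg _) ((abs_nonneg _).trans (hC x))
    · rw [norm_smul]
      exact mul_le_mul (hD x) (hC' x) (norm_nonneg _) ((abs_nonneg _).trans (hD x))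

/-- A function of one linear functional, with derivative `g'`. -/
theorem hasFDerivAt_comp_inner {g g' : ℝ → ℝ} (hg : ∀ t, HasDerivAt g (g' t) t) (a x : H) :
    HasFDerivAt (fun x => g ⟪a, x⟫) (g' ⟪a, x⟫ • innerSL ℝ a) x :=
  (hg ⟪a, x⟫).comp_hasFDerivAt x (innerSL ℝ a).hasFDerivAt

theorem isCb1_comp_inner {g g' : ℝ → ℝ} (hg : ∀ t, HasDerivAt g (g' t) t) (hc : ContDiff ℝ 1 g)
    (h1 : ∀ t, |g t| ≤ 1) (h2 : ∀ t, |g' t| ≤ 1) (a : H) : IsCb1 (fun x => g ⟪a, x⟫) := by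
  refine ⟨hc.comp (innerSL ℝ a).contDiff, ⟨1, fun x => h1 _⟩, ⟨‖a‖, fun x => ?_⟩⟩
  rw [(hasFDerivAt_comp_inner hg a x).fderiv, norm_smul, innerSL_apply_norm]
  exact mul_le_of_le_one_left (norm_nonneg _) (h2 _)

theorem isCb1_cos_inner (a : H) : IsCb1 (fun x => Real.cos ⟪a, x⟫) :=
  isCb1_comp_inner Real.hasDerivAt_cos Real.contDiff_cos Real.abs_cos_le_one
    (fun t => by rw [abs_neg]; exact Real.abs_sin_le_one t) a

theorem isCb1_sin_inner (a : H) : IsCb1 (fun x => Real.sin ⟪a, x⟫) :=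
  isCb1_comp_inner Real.hasDerivAt_sin Real.contDiff_sin Real.abs_sin_le_one
    Real.abs_cos_le_one a

theorem IsCb1.rGradient_eq (R : H →L[ℝ] H) {f : H → ℝ} (hf : IsCb1 f) (x : H) :
    rGradient R f x = R.adjoint (gradient f x) := by
  refine HasRGradientAt.rGradient (hasRGradientAt_of_tendsto fun v => ?_)
  rw [ContinuousLinearMap.adjoint_inner_left]
  have h1 := ((hf.differentiable x).hasGradientAt.hasFDerivAt.hasLineDerivAt
    (R v)).tendsto_slope_zero
  simpa [InnerProductSpace.toDual_apply_apply, div_eq_inv_mul] using h1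

theorem inner_gradient (f : H → ℝ) (x v : H) : ⟪gradient f x, v⟫ = fderiv ℝ f x v := by
  rw [gradient, InnerProductSpace.toDual_symm_apply]

theorem IsCb1.continuous_gradient {f : H → ℝ} (hf : IsCb1 f) : Continuous (gradient f) :=
  (InnerProductSpace.toDual ℝ H).symm.continuous.comp hf.continuous_fderiv

/-- The gradient of a plane wave always points along `R* a`; this makes the comparison of the two
derivatives explicit. -/
theorem rGradient_comp_inner {g g' : ℝ → ℝ} (hg : ∀ t, HasDerivAt g (g' t) t) {a : H}
    (hga : IsCb1 (fun x => g ⟪a, x⟫)) (R : H →L[ℝ] H) (x : H) :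
    rGradient R (fun x => g ⟪a, x⟫) x = g' ⟪a, x⟫ • R.adjoint a := by
  rw [hga.rGradient_eq, ← map_smul]
  congr 1
  refine ext_inner_right ℝ fun v => ?_
  rw [inner_gradient, (hasFDerivAt_comp_inner hg a x).fderiv, real_inner_smul_left]
  rfl

/-- Writing `h = R (R⁻¹ h)` and moving `R` to the other side turns the derivative along `h` into an
inner product with `R⁻¹ h`, which is the Riesz form in `H_R`. -/
theorem IsCb1.grossGradient_eq_ofVec (R : H →L[ℝ] H) {f : H → ℝ} (hf : IsCb1 f)
    (hR : R.adjoint = R) (x : H) :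
    grossGradient R f x = RangeSpace.ofVec R (rGradient R f x) := by
  refine HasGrossGradientAt.grossGradient ?_
  have h1 : HasFDerivAt (fun h : RangeSpace R => f (x + RangeSpace.incl R h))
      ((fderiv ℝ f x).comp (RangeSpace.incl R)) 0 := by
    have h2 : HasFDerivAt f (fderiv ℝ f x) (x + RangeSpace.incl R 0) := by
      rw [map_zero, add_zero]
      exact (hf.differentiable x).hasFDerivAt
    exact h2.comp 0 ((RangeSpace.incl R).hasFDerivAt.const_add x)
  rw [HasGrossGradientAt, hasGradientAt_iff_hasFDerivAt]
  refine h1.congr_fderiv (ContinuousLinearMap.ext fun h => ?_)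
  rw [InnerProductSpace.toDual_apply_apply, ContinuousLinearMap.comp_apply, ← inner_gradient,
    RangeSpace.inner_def, hf.rGradient_eq, hR]
  have h3 : RangeSpace.incl R h = R (RangeSpace.pinv R h) := (RangeSpace.apply_pinv R h).symm
  set g := gradient f x
  set w := RangeSpace.pinv R (RangeSpace.ofVec R (R g)) with hw
  have h4 : R w = R (R g) := RangeSpace.apply_pinv R _
  -- `w` and `R g` have the same image under `R`, so they differ by an element of the kernel, while
  -- the pseudo-inverse takes values in its orthogonal complement. Injectivity of `R` is not needed.
  have h5 : ⟪w - R g, RangeSpace.pinv R h⟫ = 0 :=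
    RangeSpace.pinv_mem R h _ (by
      change R (w - R g) = 0
      rw [map_sub, h4, sub_self])
  rw [inner_sub_left, sub_eq_zero] at h5
  rw [h5, h3, ← ContinuousLinearMap.adjoint_inner_left, hR]

theorem pinv_ofVec {R : H →L[ℝ] H} (hR : Function.Injective R) (v : H) :
    RangeSpace.pinv R (RangeSpace.ofVec R v) = v :=
  hR (RangeSpace.apply_pinv R _)

theorem norm_ofVec {R : H →L[ℝ] H} (hR : Function.Injective R) (v : H) :
    ‖RangeSpace.ofVec R v‖ = ‖v‖ := by
  rw [RangeSpace.norm_def, pinv_ofVec hR]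

end TestFunctions

/-! ### Uniqueness for Fourier transforms of integrable functions. -/

section Separation

variable {H : Type*} [NormedAddCommGroup H] [InnerProductSpace ℝ H] [CompleteSpace H]
  [SecondCountableTopology H] [MeasurableSpace H] [BorelSpace H]

/-- An integrable function whose Fourier transform vanishes is zero almost everywhere. -/
theorem ae_eq_zero_of_forall_integral_cos_sin {μ : Measure H} [SigmaFinite μ] {f : H → ℝ}
    (hf : Integrable f μ) (hcos : ∀ a, ∫ x, f x * Real.cos ⟪a, x⟫ ∂μ = 0)
    (hsin : ∀ a, ∫ x, f x * Real.sin ⟪a, x⟫ ∂μ = 0) : f =ᵐ[μ] 0 := by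
  have hm : AEMeasurable f μ := hf.aestronglyMeasurable.aemeasurable
  have hm' : AEMeasurable (fun x => -f x) μ := hm.neg
  -- `ENNReal.ofReal` truncates at zero, so these two densities are the positive and negative parts
  -- of `f`. Both measures are finite, and characteristic functions determine them.
  have : IsFiniteMeasure (μ.withDensity fun x => ENNReal.ofReal (f x)) :=
    isFiniteMeasure_withDensity_ofReal hf.2
  have : IsFiniteMeasure (μ.withDensity fun x => ENNReal.ofReal (-f x)) :=
    isFiniteMeasure_withDensity_ofReal hf.neg.2
  have hchar : (μ.withDensity fun x => ENNReal.ofReal (f x)) =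
      μ.withDensity fun x => ENNReal.ofReal (-f x) := by
    refine Measure.ext_of_charFun (funext fun a => ?_)
    have hE : Continuous fun x : H => Complex.exp (⟪x, a⟫ * Complex.I) := by fun_prop
    have hEn : ∀ x : H, ‖Complex.exp (⟪x, a⟫ * Complex.I)‖ ≤ 1 := fun x =>
      (Complex.norm_exp_ofReal_mul_I _).le
    have hint : ∀ g : H → ℝ, Integrable g μ →
        Integrable (fun x => g x • Complex.exp (⟪x, a⟫ * Complex.I)) μ := fun g hg => by
      simpa [mul_comm] using hg.ofReal.bdd_mul (c := 1) hE.aestronglyMeasurable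
        (ae_of_all _ hEn)
    rw [charFun_apply, charFun_apply,
      integral_withDensity_eq_integral_toReal_smul₀ hm.ennreal_ofReal (by simp),
      integral_withDensity_eq_integral_toReal_smul₀ hm'.ennreal_ofReal (by simp),
      ← sub_eq_zero, ← integral_sub]
    -- Since `f⁺ - f⁻ = f`, the two characteristic functions differ by the Fourier integral of `f`,
    -- whose real and imaginary parts vanish by hypothesis.
    · have h1 : ∀ x, (ENNReal.ofReal (f x)).toReal • Complex.exp (⟪x, a⟫ * Complex.I) -
          (ENNReal.ofReal (-f x)).toReal • Complex.exp (⟪x, a⟫ * Complex.I) =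
          ((f x * Real.cos ⟪a, x⟫ : ℝ) : ℂ) + ((f x * Real.sin ⟪a, x⟫ : ℝ) : ℂ) * Complex.I := by
        intro x
        rw [← sub_smul, ENNReal.toReal_ofReal', ENNReal.toReal_ofReal', max_zero_sub_eq_self,
          Complex.exp_mul_I, real_inner_comm, Complex.real_smul]
        push_cast
        ring
      simp_rw [h1]
      have hc : Integrable (fun x => f x * Real.cos ⟪a, x⟫) μ :=
        hf.mul_bdd (c := 1) (by fun_prop : Continuous _).aestronglyMeasurable
          (ae_of_all _ fun x => Real.abs_cos_le_one _)
      have hs : Integrable (fun x => f x * Real.sin ⟪a, x⟫) μ :=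
        hf.mul_bdd (c := 1) (by fun_prop : Continuous _).aestronglyMeasurable
          (ae_of_all _ fun x => Real.abs_sin_le_one _)
      rw [integral_add hc.ofReal (hs.ofReal.mul_const _), integral_mul_const,
        integral_complex_ofReal, integral_complex_ofReal, hcos, hsin]
      simp
    · simp_rw [ENNReal.toReal_ofReal']
      exact hint _ hf.pos_part
    · simp_rw [ENNReal.toReal_ofReal']
      exact hint _ hf.neg.pos_part
  have h := (withDensity_eq_iff_of_sigmaFinite hm.ennreal_ofReal hm'.ennreal_ofReal).mp hchar
  filter_upwards [h] with x hx
  have h2 := congrArg ENNReal.toReal hx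
  rw [ENNReal.toReal_ofReal', ENNReal.toReal_ofReal', ← sub_eq_zero, max_zero_sub_eq_self] at h2
  exact h2

end Separation

/-! ### Gaussian integration by parts through rotations. -/

section IntegrationByParts

variable {H : Type*} [NormedAddCommGroup H] [InnerProductSpace ℝ H] [CompleteSpace H]
  [SecondCountableTopology H] [MeasurableSpace H] [BorelSpace H]

theorem norm_cos_smul_add_sin_smul_le (θ : ℝ) (x y : H) :
    ‖Real.cos θ • x + Real.sin θ • y‖ ≤ ‖x‖ + ‖y‖ := by
  refine (norm_add_le _ _).trans ?_
  rw [norm_smul, norm_smul]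
  exact add_le_add (mul_le_of_le_one_left (norm_nonneg _) (Real.abs_cos_le_one θ))
    (mul_le_of_le_one_left (norm_nonneg _) (Real.abs_sin_le_one θ))

theorem norm_neg_sin_smul_add_cos_smul_le (θ : ℝ) (x y : H) :
    ‖-Real.sin θ • x + Real.cos θ • y‖ ≤ ‖x‖ + ‖y‖ := by
  refine (norm_add_le _ _).trans ?_
  rw [norm_smul, norm_smul, norm_neg]
  exact add_le_add (mul_le_of_le_one_left (norm_nonneg _) (Real.abs_sin_le_one θ))
    (mul_le_of_le_one_left (norm_nonneg _) (Real.abs_cos_le_one θ))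

/-- Integration by parts for a centered Gaussian measure, obtained by differentiating the rotation
invariance of `γ ⊗ γ`. -/
theorem IsCb1.integral_fderiv_covarianceOperator {γ : Measure H} [IsGaussian γ]
    (hγ : ∫ x, x ∂γ = 0) {φ : H → ℝ} (hφ : IsCb1 φ) (k : H) :
    ∫ x, fderiv ℝ φ x (covarianceOperator γ k) ∂γ = ∫ x, φ x * ⟪k, x⟫ ∂γ := by
  obtain ⟨C, hC⟩ := hφ.bounded
  obtain ⟨D, hD⟩ := hφ.bounded_fderiv
  have hφc := hφ.continuous
  have hφd := hφ.continuous_fderiv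
  -- `(u, w)` is the pair `p` rotated by `θ`, with `∂u = w` and `∂w = -u`; hence `F'` is the
  -- `θ`-derivative of `F`.
  let u : ℝ → H × H → H := fun θ p => Real.cos θ • p.1 + Real.sin θ • p.2
  let w : ℝ → H × H → H := fun θ p => -Real.sin θ • p.1 + Real.cos θ • p.2
  let F : ℝ → H × H → ℝ := fun θ p => φ (u θ p) * ⟪k, w θ p⟫
  let F' : ℝ → H × H → ℝ := fun θ p =>
    fderiv ℝ φ (u θ p) (w θ p) * ⟪k, w θ p⟫ + φ (u θ p) * ⟪k, -u θ p⟫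
  -- This function dominates `‖u‖` and `‖w‖` uniformly in `θ`; its square integrability rests on the
  -- finite second moment of `γ`.
  have hs : MemLp (fun p : H × H => ‖p.1‖ + ‖p.2‖) 2 (γ.prod γ) :=
    ((IsGaussian.memLp_two_id (μ := γ)).norm.comp_measurePreserving measurePreserving_fst).add
      ((IsGaussian.memLp_two_id (μ := γ)).norm.comp_measurePreserving measurePreserving_snd)
  have hs1 := hs.integrable one_le_two
  have hs2 := hs.integrable_sq
  have hu : ∀ θ, Continuous (u θ) := fun θ => by fun_prop
  have hw : ∀ θ, Continuous (w θ) := fun θ => by fun_prop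
  have hFc : ∀ θ, Continuous (F θ) := fun θ => by
    have := hu θ
    have := hw θ
    fun_prop
  have hF'c : ∀ θ, Continuous (F' θ) := fun θ => by
    have := hu θ
    have := hw θ
    exact ((hφd.comp (hu θ)).clm_apply (hw θ) |>.mul (by fun_prop)).add (by fun_prop)
  have hFint : Integrable (F 0) (γ.prod γ) := by
    refine (hs1.const_mul (C * ‖k‖)).mono' (hFc 0).aestronglyMeasurable (ae_of_all _ fun p => ?_)
    rw [Real.norm_eq_abs, abs_mul, mul_assoc]
    exact mul_le_mul (hC _) ((abs_real_inner_le_norm _ _).trans (mul_le_mul_of_nonneg_left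
      (norm_neg_sin_smul_add_cos_smul_le 0 p.1 p.2) (norm_nonneg _))) (abs_nonneg _)
      ((abs_nonneg _).trans (hC 0))
  have hder := hasDerivAt_integral_of_dominated_loc_of_deriv_le (μ := γ.prod γ) (F := F) (F' := F')
    (x₀ := (0 : ℝ)) (s := Set.univ)
    -- The quadratic term bounds `Dφ(u) w * ⟪k, w⟫`, the linear one `φ(u) * ⟪k, -u⟫`.
    (bound := fun p => D * ‖k‖ * (‖p.1‖ + ‖p.2‖) ^ 2 + C * ‖k‖ * (‖p.1‖ + ‖p.2‖))
    univ_mem (Eventually.of_forall fun θ => (hFc θ).aestronglyMeasurable) hFint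
    (hF'c 0).aestronglyMeasurable
    (ae_of_all _ fun p θ _ => by
      have hun : ‖u θ p‖ ≤ ‖p.1‖ + ‖p.2‖ := norm_cos_smul_add_sin_smul_le θ p.1 p.2
      have hwn : ‖w θ p‖ ≤ ‖p.1‖ + ‖p.2‖ := norm_neg_sin_smul_add_cos_smul_le θ p.1 p.2
      have hD0 := (norm_nonneg _).trans (hD 0)
      have hC0 := (abs_nonneg _).trans (hC 0)
      have hn : 0 ≤ ‖p.1‖ + ‖p.2‖ := by positivity
      refine (norm_add_le _ _).trans (add_le_add ?_ ?_)
      · rw [norm_mul]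
        have e1 : ‖fderiv ℝ φ (u θ p) (w θ p)‖ ≤ D * (‖p.1‖ + ‖p.2‖) :=
          (ContinuousLinearMap.le_opNorm _ _).trans (mul_le_mul (hD _) hwn (norm_nonneg _) hD0)
        have e2 : ‖⟪k, w θ p⟫‖ ≤ ‖k‖ * (‖p.1‖ + ‖p.2‖) :=
          (norm_inner_le_norm _ _).trans (mul_le_mul_of_nonneg_left hwn (norm_nonneg _))
        calc _ ≤ D * (‖p.1‖ + ‖p.2‖) * (‖k‖ * (‖p.1‖ + ‖p.2‖)) :=
              mul_le_mul e1 e2 (norm_nonneg _) (mul_nonneg hD0 hn)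
          _ = _ := by ring
      · rw [norm_mul, mul_assoc]
        refine mul_le_mul (hC _) ?_ (norm_nonneg _) hC0
        refine (norm_inner_le_norm _ _).trans (mul_le_mul_of_nonneg_left ?_ (norm_nonneg _))
        rwa [norm_neg])
    ((hs2.const_mul _).add (hs1.const_mul _))
    (ae_of_all _ fun p θ _ => by
      have hu' : HasDerivAt (fun θ => u θ p) (w θ p) θ :=
        ((Real.hasDerivAt_cos θ).smul_const p.1).add ((Real.hasDerivAt_sin θ).smul_const p.2)
      have hw' : HasDerivAt (fun θ => w θ p) (-u θ p) θ := by
        refine (((Real.hasDerivAt_sin θ).neg.smul_const p.1).add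
          ((Real.hasDerivAt_cos θ).smul_const p.2)).congr_deriv ?_
        simp only [u, neg_add, neg_smul]
      have h1 : HasDerivAt (fun θ => φ (u θ p)) (fderiv ℝ φ (u θ p) (w θ p)) θ :=
        (hφ.differentiable _).hasFDerivAt.comp_hasDerivAt θ hu'
      have h2 : HasDerivAt (fun θ => ⟪k, w θ p⟫) ⟪k, -u θ p⟫ θ :=
        (innerSL ℝ k).hasFDerivAt.comp_hasDerivAt θ hw'
      exact h1.mul h2)
  -- Since `γ` is centered, the rotated pair has the same law `γ ⊗ γ`, so the integral does not
  -- depend on `θ`.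
  have hconst : ∀ θ, ∫ p, F θ p ∂(γ.prod γ) = ∫ p, φ p.1 * ⟪k, p.2⟫ ∂(γ.prod γ) := by
    intro θ
    conv_rhs => rw [← IsGaussian.map_rotation_eq_self (μ := γ) hγ θ]
    rw [integral_map (by fun_prop) (by fun_prop : Continuous _).aestronglyMeasurable]
    rfl
  have hzero : ∫ p, F' 0 p ∂(γ.prod γ) = 0 := by
    refine hder.2.unique ?_
    rw [show (fun θ => ∫ p, F θ p ∂(γ.prod γ)) = _ from funext hconst]
    exact hasDerivAt_const _ _
  have hF'0 : ∀ p : H × H, F' 0 p = fderiv ℝ φ p.1 p.2 * ⟪k, p.2⟫ - φ p.1 * ⟪k, p.1⟫ := by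
    intro p
    simp [F', u, w, inner_neg_right, sub_eq_add_neg]
  -- Integrating `⟪∇φ(x), y⟫ * ⟪k, y⟫` in `y` produces the covariance; the other term is constant in
  -- `y`.
  have hin : ∀ x, ∫ y, F' 0 (x, y) ∂γ =
      fderiv ℝ φ x (covarianceOperator γ k) - φ x * ⟪k, x⟫ := by
    intro x
    simp_rw [hF'0]
    rw [integral_sub, integral_const, probReal_univ, one_smul, ← inner_gradient,
      real_inner_comm _ (gradient φ x), covarianceOperator_inner IsGaussian.memLp_two_id]
    · simp_rw [inner_gradient, mul_comm]
    · simp_rw [← inner_gradient]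
      exact MemLp.integrable_mul (IsGaussian.memLp_two_id.const_inner _)
        (IsGaussian.memLp_two_id.const_inner _)
    · exact integrable_const _
  rw [integral_prod _ hder.1] at hzero
  simp_rw [hin] at hzero
  rwa [integral_sub, sub_eq_zero] at hzero
  · refine Integrable.of_bound (C := D * ‖covarianceOperator γ k‖)
      (hφd.clm_apply continuous_const).aestronglyMeasurable (ae_of_all _ fun x => ?_)
    exact ((fderiv ℝ φ x).le_opNorm _).trans (mul_le_mul_of_nonneg_right (hD x) (norm_nonneg _))
  · exact ((IsGaussian.memLp_two_id.const_inner k).integrable one_le_two).bdd_mul (c := C)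
      hφc.aestronglyMeasurable (ae_of_all _ hC)

end IntegrationByParts

end Malliavin

namespace Malliavin

/-! ### The covariance operator and its square root. -/

section SquareRootOfCovariance

variable {H : Type*} [NormedAddCommGroup H] [InnerProductSpace ℝ H] [CompleteSpace H]
  [MeasurableSpace H] [BorelSpace H]

theorem isPositive_covarianceOperator' (γ : Measure H) : (covarianceOperator γ).IsPositive :=
  (ContinuousLinearMap.isPositive_toLinearMap_iff _).mp isPositive_covarianceOperator

theorem isPositive_sqrtCov (γ : Measure H) : (sqrtCov γ).IsPositive :=
  (opSqrt_spec (isPositive_covarianceOperator' γ)).1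

theorem sqrtCov_mul_self (γ : Measure H) : sqrtCov γ * sqrtCov γ = covarianceOperator γ :=
  (opSqrt_spec (isPositive_covarianceOperator' γ)).2

theorem sqrtCov_sqrtCov (γ : Measure H) (x : H) :
    sqrtCov γ (sqrtCov γ x) = covarianceOperator γ x := by
  rw [← sqrtCov_mul_self]
  rfl

theorem adjoint_sqrtCov (γ : Measure H) :
    ContinuousLinearMap.adjoint (sqrtCov γ) = sqrtCov γ :=
  (isPositive_sqrtCov γ).isSelfAdjoint.adjoint_eq

theorem sqrtCov_injective {γ : Measure H}
    (hγ : LinearMap.ker (covarianceOperator γ : H →ₗ[ℝ] H) = ⊥) :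
    Function.Injective (sqrtCov γ) := by
  refine (injective_iff_map_eq_zero _).mpr fun x hx => ?_
  have h : x ∈ LinearMap.ker (covarianceOperator γ : H →ₗ[ℝ] H) := by
    change covarianceOperator γ x = 0
    rw [← sqrtCov_sqrtCov, hx, map_zero]
  rwa [hγ] at h

theorem sqrtCov_eq_id_iff (γ : Measure H) :
    sqrtCov γ = ContinuousLinearMap.id ℝ H ↔
      covarianceOperator γ = ContinuousLinearMap.id ℝ H := by
  constructor
  · intro h
    rw [← sqrtCov_mul_self, h]
    rfl
  · intro h
    exact (existsUnique_sqrt _ (isPositive_covarianceOperator' γ)).unique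
      ⟨isPositive_sqrtCov γ, sqrtCov_mul_self γ⟩
      ⟨ContinuousLinearMap.isPositive_one, by rw [h]; rfl⟩

/-- If `Q = Id`, every coordinate in an orthonormal basis has second moment one, so by Bessel's
inequality any `n` of them give `n ≤ ∫ ‖x‖²`, which is finite. -/
theorem covarianceOperator_ne_id [SecondCountableTopology H] (γ : Measure H) [IsGaussian γ]
    (hH : ¬ FiniteDimensional ℝ H) : covarianceOperator γ ≠ ContinuousLinearMap.id ℝ H := by
  intro hQ
  obtain ⟨w, b, hb⟩ := exists_hilbertBasis ℝ H
  have hw : w.Infinite := by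
    intro hfin
    have := hfin.fintype
    refine hH ?_
    exact Module.Finite.of_basis b.toOrthonormalBasis.toBasis
  have hL2 : MemLp (fun x : H => x) 2 γ := IsGaussian.memLp_two_id
  have hsq : Integrable (fun x : H => ‖x‖ ^ 2) γ := hL2.norm.integrable_sq
  obtain ⟨n, hn⟩ := exists_nat_gt (∫ x, ‖x‖ ^ 2 ∂γ)
  have := hw.to_subtype
  obtain ⟨s, hs⟩ := Infinite.exists_subset_card_eq w n
  have h1 : ∀ i, ∫ x, ⟪b i, x⟫ ^ 2 ∂γ = 1 := fun i => by
    have h := covarianceOperator_inner hL2 (b i) (b i)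
    rw [hQ] at h
    simp_rw [pow_two]
    rw [← h, ContinuousLinearMap.id_apply, real_inner_self_eq_norm_sq, b.orthonormal.1 i, one_pow]
  have h2 : (n : ℝ) ≤ ∫ x, ‖x‖ ^ 2 ∂γ :=
    calc (n : ℝ) = ∑ i ∈ s, ∫ x, ⟪b i, x⟫ ^ 2 ∂γ := by simp [h1, hs]
      _ = ∫ x, ∑ i ∈ s, ⟪b i, x⟫ ^ 2 ∂γ :=
        (integral_finsetSum _ fun i _ => (hL2.const_inner (b i)).integrable_sq).symm
      _ ≤ ∫ x, ‖x‖ ^ 2 ∂γ := by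
        refine integral_mono
          (integrable_finsetSum _ fun i _ => (hL2.const_inner (b i)).integrable_sq) hsq fun x => ?_
        simpa using b.orthonormal.sum_inner_products_le x (s := s)
  exact absurd hn (not_lt.mpr h2)

end SquareRootOfCovariance

/-! ### Closability of the Cannarsa--Da Prato gradient. -/

section Closability

variable {H : Type*} [NormedAddCommGroup H] [InnerProductSpace ℝ H] [CompleteSpace H]
  [SecondCountableTopology H] [MeasurableSpace H] [BorelSpace H]

theorem IsCb1.memLp {γ : Measure H} [IsFiniteMeasure γ] {φ : H → ℝ} (hφ : IsCb1 φ) :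
    MemLp φ 2 γ := by
  obtain ⟨C, hC⟩ := hφ.bounded
  exact MemLp.of_bound hφ.continuous.aestronglyMeasurable C (ae_of_all _ hC)

theorem IsCb1.memLp_rGradient {γ : Measure H} [IsFiniteMeasure γ] {φ : H → ℝ} (hφ : IsCb1 φ)
    (R : H →L[ℝ] H) : MemLp (rGradient R φ) 2 γ := by
  obtain ⟨C, hC⟩ := hφ.bounded_fderiv
  have h : MemLp (gradient φ) 2 γ :=
    MemLp.of_bound hφ.continuous_gradient.aestronglyMeasurable C (ae_of_all _ fun x => by
      rw [gradient, LinearIsometryEquiv.norm_map]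
      exact hC x)
  rw [funext (hφ.rGradient_eq R)]
  exact R.adjoint.comp_memLp' h

/-- With `v = Q k` this function is the divergence of the field `ψ • Q^{1/2} k`; being in `L²`, it
pairs continuously with `L²` functions. -/
theorem memLp_mul_inner_sub_fderiv {γ : Measure H} [IsGaussian γ] {ψ : H → ℝ} (hψ : IsCb1 ψ)
    (k v : H) : MemLp (fun x => ψ x * ⟪k, x⟫ - fderiv ℝ ψ x v) 2 γ := by
  obtain ⟨C, hC⟩ := hψ.bounded
  obtain ⟨D, hD⟩ := hψ.bounded_fderiv
  refine MemLp.sub ?_ ?_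
  · have hk : MemLp (fun x : H => ⟪k, x⟫) 2 γ := IsGaussian.memLp_two_id.const_inner k
    refine MemLp.of_le_mul (c := C) hk
      (hψ.continuous.mul (by fun_prop)).aestronglyMeasurable (ae_of_all _ fun x => ?_)
    rw [norm_mul]
    exact mul_le_mul_of_nonneg_right (hC x) (norm_nonneg _)
  · exact MemLp.of_bound (hψ.continuous_fderiv.clm_apply continuous_const).aestronglyMeasurable
      (D * ‖v‖) (ae_of_all _ fun x => ((fderiv ℝ ψ x).le_opNorm v).trans
        (mul_le_mul_of_nonneg_right (hD x) (norm_nonneg _)))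

/-- Integration by parts against a test function. -/
theorem integral_smul_rGradient_inner {γ : Measure H} [IsGaussian γ] (hγ : ∫ x, x ∂γ = 0)
    {φ ψ : H → ℝ} (hφ : IsCb1 φ) (hψ : IsCb1 ψ) (k : H) :
    ∫ x, ⟪ψ x • sqrtCov γ k, rGradient (sqrtCov γ) φ x⟫ ∂γ =
      ∫ x, ⟪ψ x * ⟪k, x⟫ - fderiv ℝ ψ x (covarianceOperator γ k), φ x⟫ ∂γ := by
  -- The product rule for `φψ` along `Q k`, with `⟪Q^{1/2} k, Q^{1/2} ∇φ⟫ = ⟪Q k, ∇φ⟫`.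
  have hpt : ∀ x, ⟪ψ x • sqrtCov γ k, rGradient (sqrtCov γ) φ x⟫ =
      fderiv ℝ (fun x => φ x * ψ x) x (covarianceOperator γ k) -
        φ x * fderiv ℝ ψ x (covarianceOperator γ k) := by
    intro x
    rw [fderiv_fun_mul (hφ.differentiable x) (hψ.differentiable x), real_inner_smul_left,
      hφ.rGradient_eq, ContinuousLinearMap.adjoint_inner_right, sqrtCov_sqrtCov, real_inner_comm,
      inner_gradient]
    simp
  have hint : ∀ {f : H → ℝ}, IsCb1 f →
      MemLp (fun x => fderiv ℝ f x (covarianceOperator γ k)) 2 γ := by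
    intro f hf
    obtain ⟨D, hD⟩ := hf.bounded_fderiv
    exact MemLp.of_bound (hf.continuous_fderiv.clm_apply continuous_const).aestronglyMeasurable
      (D * ‖covarianceOperator γ k‖) (ae_of_all _ fun x => ((fderiv ℝ f x).le_opNorm _).trans
        (mul_le_mul_of_nonneg_right (hD x) (norm_nonneg _)))
  have h2 : Integrable (fun x => φ x * fderiv ℝ ψ x (covarianceOperator γ k)) γ :=
    (hφ.memLp (γ := γ)).integrable_mul (hint hψ)
  have h3 : Integrable (fun x => φ x * ψ x * ⟪k, x⟫) γ :=
    ((hφ.mul hψ).memLp (γ := γ)).integrable_mul (IsGaussian.memLp_two_id.const_inner k)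
  simp_rw [hpt]
  rw [integral_sub ((hint (hφ.mul hψ)).integrable one_le_two) h2,
    (hφ.mul hψ).integral_fderiv_covarianceOperator hγ, ← integral_sub h3 h2]
  refine integral_congr_ae (ae_of_all _ fun x => ?_)
  simp only [RCLike.inner_apply, conj_trivial]
  ring

/-- Both sides are inner products with fixed elements of `L²`, so the identity is a closed condition
and passes from the graph to its closure. -/
theorem integral_smul_inner_of_mem_closure_rGraph {γ : Measure H} [IsGaussian γ]
    (hγ : ∫ x, x ∂γ = 0) {p : Lp ℝ 2 γ × Lp H 2 γ}
    (hp : p ∈ (rGraph (sqrtCov γ) γ).topologicalClosure) {ψ : H → ℝ} (hψ : IsCb1 ψ) (k : H) :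
    ∫ x, ⟪ψ x • sqrtCov γ k, p.2 x⟫ ∂γ =
      ∫ x, ⟪ψ x * ⟪k, x⟫ - fderiv ℝ ψ x (covarianceOperator γ k), p.1 x⟫ ∂γ := by
  have hA : MemLp (fun x => ψ x • sqrtCov γ k) 2 γ := by
    obtain ⟨C, hC⟩ := hψ.bounded
    refine MemLp.of_bound (hψ.continuous.smul continuous_const).aestronglyMeasurable
      (C * ‖sqrtCov γ k‖) (ae_of_all _ fun x => ?_)
    rw [norm_smul]
    exact mul_le_mul_of_nonneg_right (hC x) (norm_nonneg _)
  have hB := memLp_mul_inner_sub_fderiv (γ := γ) hψ k (covarianceOperator γ k)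
  have e1 : ∀ q : Lp ℝ 2 γ × Lp H 2 γ,
      ⟪hA.toLp _, q.2⟫ = ∫ x, ⟪ψ x • sqrtCov γ k, q.2 x⟫ ∂γ := fun q => by
    rw [L2.inner_def]
    refine integral_congr_ae ?_
    filter_upwards [hA.coeFn_toLp] with x hx
    rw [hx]
  have e2 : ∀ q : Lp ℝ 2 γ × Lp H 2 γ, ⟪hB.toLp _, q.1⟫ =
      ∫ x, ⟪ψ x * ⟪k, x⟫ - fderiv ℝ ψ x (covarianceOperator γ k), q.1 x⟫ ∂γ := fun q => by
    rw [L2.inner_def]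
    refine integral_congr_ae ?_
    filter_upwards [hB.coeFn_toLp] with x hx
    rw [hx]
  rw [← e1, ← e2]
  have hclosed : IsClosed {q : Lp ℝ 2 γ × Lp H 2 γ | ⟪hA.toLp _, q.2⟫ = ⟪hB.toLp _, q.1⟫} :=
    isClosed_eq (by fun_prop) (by fun_prop)
  refine closure_minimal ?_ hclosed hp
  rintro q ⟨φ, hφ, h1, h2⟩
  change ⟪hA.toLp _, q.2⟫ = ⟪hB.toLp _, q.1⟫
  rw [e1, e2]
  calc _ = ∫ x, ⟪ψ x • sqrtCov γ k, rGradient (sqrtCov γ) φ x⟫ ∂γ :=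
        integral_congr_ae (by filter_upwards [h2] with x hx; rw [hx])
    _ = _ := integral_smul_rGradient_inner hγ hφ hψ k
    _ = _ := integral_congr_ae (by filter_upwards [h1] with x hx; rw [hx])

/-- The limiting integration by parts makes each component of `Q^{1/2} p.2` orthogonal to all test
functions; plane waves already separate integrable functions, and `Q^{1/2}` is injective. -/
theorem snd_eq_zero_of_mem_closure_rGraph {γ : Measure H} [IsGaussian γ] (hγ : ∫ x, x ∂γ = 0)
    (hR : Function.Injective (sqrtCov γ)) {p : Lp ℝ 2 γ × Lp H 2 γ}
    (hp : p ∈ (rGraph (sqrtCov γ) γ).topologicalClosure) (h0 : p.1 = 0) : p.2 = 0 := by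
  have hz : ∀ {ψ : H → ℝ}, IsCb1 ψ → ∀ k, ∫ x, ⟪k, sqrtCov γ (p.2 x)⟫ * ψ x ∂γ = 0 := by
    intro ψ hψ k
    have h := integral_smul_inner_of_mem_closure_rGraph hγ hp hψ k
    rw [h0] at h
    have hr : ∫ x, ⟪ψ x * ⟪k, x⟫ - fderiv ℝ ψ x (covarianceOperator γ k),
        (0 : Lp ℝ 2 γ) x⟫ ∂γ = 0 := by
      rw [← integral_zero H ℝ (μ := γ)]
      refine integral_congr_ae ?_
      filter_upwards [Lp.coeFn_zero ℝ 2 γ] with x hx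
      rw [hx]
      simp
    rw [hr] at h
    rw [← h]
    refine integral_congr_ae (ae_of_all _ fun x => ?_)
    simp only
    rw [real_inner_smul_left, mul_comm, ← ContinuousLinearMap.adjoint_inner_left, adjoint_sqrtCov]
  have hRp : (fun x => sqrtCov γ (p.2 x)) =ᵐ[γ] 0 := by
    refine ae_eq_zero_of_forall_inner (𝕜 := ℝ) fun k => ?_
    have hm : MemLp (fun x => sqrtCov γ (p.2 x)) 2 γ := (sqrtCov γ).comp_memLp' (Lp.memLp p.2)
    exact ae_eq_zero_of_forall_integral_cos_sin ((hm.const_inner k).integrable one_le_two)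
      (fun a => hz (isCb1_cos_inner a) k) (fun a => hz (isCb1_sin_inner a) k)
  refine (Lp.eq_zero_iff_ae_eq_zero).mpr ?_
  filter_upwards [hRp] with x hx
  exact hR (by rw [hx]; simp)

end Closability

/-! ### Transfer between `H`-valued and `H_R`-valued gradients. -/

section Transfer

variable {H : Type*} [NormedAddCommGroup H] [InnerProductSpace ℝ H] [CompleteSpace H]

/-- `R`, as a linear isometry from `H` onto `H_R`, when `R` is injective. -/
noncomputable def ofVecEquiv (R : H →L[ℝ] H) (hR : Function.Injective R) :
    H ≃ₗᵢ[ℝ] RangeSpace R where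
  toFun := RangeSpace.ofVec R
  invFun := RangeSpace.pinv R
  map_add' := map_add _
  map_smul' := map_smul _
  left_inv := pinv_ofVec hR
  right_inv h := RangeSpace.inclₗ_injective R (RangeSpace.apply_pinv R h)
  norm_map' := norm_ofVec hR

variable [MeasurableSpace H]

theorem compLpL_ofVec_pinv (R : H →L[ℝ] H) (hR : Function.Injective R) (γ : Measure H)
    (g : Lp (RangeSpace R) 2 γ) :
    (RangeSpace.ofVec R).compLpL 2 γ
      (((ofVecEquiv R hR).symm.toContinuousLinearEquiv : RangeSpace R →L[ℝ] H).compLpL 2 γ g) =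
      g := by
  refine Lp.ext ?_
  refine (ContinuousLinearMap.coeFn_compLpL _ _).trans ?_
  filter_upwards [ContinuousLinearMap.coeFn_compLpL
    ((ofVecEquiv R hR).symm.toContinuousLinearEquiv : RangeSpace R →L[ℝ] H) g] with x hx
  rw [hx]
  exact (ofVecEquiv R hR).apply_symm_apply _

theorem compLpL_pinv_ofVec (R : H →L[ℝ] H) (hR : Function.Injective R) (γ : Measure H)
    (g : Lp H 2 γ) :
    ((ofVecEquiv R hR).symm.toContinuousLinearEquiv : RangeSpace R →L[ℝ] H).compLpL 2 γ
      ((RangeSpace.ofVec R).compLpL 2 γ g) = g := by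
  refine Lp.ext ?_
  refine (ContinuousLinearMap.coeFn_compLpL _ _).trans ?_
  filter_upwards [ContinuousLinearMap.coeFn_compLpL (RangeSpace.ofVec R) g] with x hx
  rw [hx]
  exact (ofVecEquiv R hR).symm_apply_apply _

/-- Composition with `R`, as an isomorphism from `L²(γ; H)` onto `L²(γ; H_R)`. -/
noncomputable def lpOfVecEquiv (R : H →L[ℝ] H) (hR : Function.Injective R) (γ : Measure H) :
    Lp H 2 γ ≃L[ℝ] Lp (RangeSpace R) 2 γ :=
  ContinuousLinearEquiv.equivOfInverse ((RangeSpace.ofVec R).compLpL 2 γ)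
    (((ofVecEquiv R hR).symm.toContinuousLinearEquiv : RangeSpace R →L[ℝ] H).compLpL 2 γ)
    (compLpL_pinv_ofVec R hR γ) (compLpL_ofVec_pinv R hR γ)

theorem lpOfVecEquiv_apply (R : H →L[ℝ] H) (hR : Function.Injective R) (γ : Measure H)
    (g : Lp H 2 γ) : lpOfVecEquiv R hR γ g = (RangeSpace.ofVec R).compLpL 2 γ g := rfl

theorem norm_lpOfVecEquiv (R : H →L[ℝ] H) (hR : Function.Injective R) (γ : Measure H)
    (g : Lp H 2 γ) : ‖lpOfVecEquiv R hR γ g‖ = ‖g‖ := by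
  rw [Lp.norm_def, Lp.norm_def]
  refine congrArg ENNReal.toReal (eLpNorm_congr_norm_ae ?_)
  filter_upwards [ContinuousLinearMap.coeFn_compLpL (RangeSpace.ofVec R) g] with x hx
  rw [lpOfVecEquiv_apply, hx, norm_ofVec hR]

/-- The same `φ` witnesses both sides, because its Gross gradient is `R` applied to its `R`-gradient
and `R` is injective. -/
theorem mem_grossGraph_iff (R : H →L[ℝ] H) (hR : Function.Injective R)
    (hRa : ContinuousLinearMap.adjoint R = R) (γ : Measure H) (f : Lp ℝ 2 γ) (g : Lp H 2 γ) :
    (f, lpOfVecEquiv R hR γ g) ∈ grossGraph R γ ↔ (f, g) ∈ rGraph R γ := by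
  have key : ∀ {φ : H → ℝ}, IsCb1 φ →
      (lpOfVecEquiv R hR γ g =ᵐ[γ] grossGradient R φ ↔ g =ᵐ[γ] rGradient R φ) := by
    intro φ hφ
    have hc := ContinuousLinearMap.coeFn_compLpL (RangeSpace.ofVec R) g
    constructor
    · intro h
      filter_upwards [h, hc] with x hx hx2
      rw [lpOfVecEquiv_apply, hx2, hφ.grossGradient_eq_ofVec R hRa] at hx
      exact (ofVecEquiv R hR).injective hx
    · intro h
      filter_upwards [h, hc] with x hx hx2
      rw [lpOfVecEquiv_apply, hx2, hφ.grossGradient_eq_ofVec R hRa, hx]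
  exact exists_congr fun φ => and_congr_right fun hφ => and_congr_right fun _ => key hφ

/-- One graph is the preimage of the other under a homeomorphism, and such preimages commute with
closures. -/
theorem mem_closure_grossGraph_iff (R : H →L[ℝ] H) (hR : Function.Injective R)
    (hRa : ContinuousLinearMap.adjoint R = R) (γ : Measure H) (f : Lp ℝ 2 γ) (g : Lp H 2 γ) :
    (f, lpOfVecEquiv R hR γ g) ∈ (grossGraph R γ).topologicalClosure ↔
      (f, g) ∈ (rGraph R γ).topologicalClosure := by
  let e := ((Homeomorph.refl (Lp ℝ 2 γ)).prodCongr (lpOfVecEquiv R hR γ).toHomeomorph)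
  have h : e ⁻¹' (grossGraph R γ : Set _) = rGraph R γ :=
    Set.ext fun q => mem_grossGraph_iff R hR hRa γ q.1 q.2
  have h2 := e.preimage_closure (grossGraph R γ : Set _)
  rw [h] at h2
  exact Set.ext_iff.mp h2 (f, g)

end Transfer

end Malliavin

namespace Malliavin

/-! ### Closures of operators given by their graphs. -/

section LinearPMap

variable {E F : Type*} [NormedAddCommGroup E] [NormedSpace ℝ E] [NormedAddCommGroup F]
  [NormedSpace ℝ F]

/-- A subspace whose closure is a graph defines a closable operator, and the graph of the closure
is the closure of the subspace. -/
theorem isClosable_toLinearPMap {g : Submodule ℝ (E × F)}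
    (hg : ∀ p ∈ g.topologicalClosure, p.1 = 0 → p.2 = 0) :
    g.toLinearPMap.IsClosable ∧ g.toLinearPMap.closure.graph = g.topologicalClosure := by
  -- A submodule is the graph of its `toLinearPMap` only when it is single-valued; here it inherits
  -- this from its closure.
  have h1 : g.toLinearPMap.graph = g :=
    g.toLinearPMap_graph_eq fun p hp => hg p (g.le_topologicalClosure hp)
  have h2 : g.toLinearPMap.IsClosable :=
    ⟨g.topologicalClosure.toLinearPMap, by rw [h1, Submodule.toLinearPMap_graph_eq _ hg]⟩
  exact ⟨h2, by rw [← h2.graph_closure_eq_closure_graph, h1]⟩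

theorem exists_apply_eq_of_mem_graph {D : E →ₗ.[ℝ] F} {x : E} {y : F} (h : (x, y) ∈ D.graph) :
    ∃ f : D.domain, (f : E) = x ∧ D f = y :=
  (LinearPMap.mem_graph_iff D).mp h

end LinearPMap

/-! ### Comparison of the two Malliavin derivatives. -/

variable {H : Type*} [NormedAddCommGroup H] [InnerProductSpace ℝ H] [CompleteSpace H]
  [SecondCountableTopology H] [MeasurableSpace H] [BorelSpace H]

theorem snd_eq_zero_of_mem_closure_grossGraph {γ : Measure H} [IsGaussian γ]
    (hγ : ∫ x, x ∂γ = 0) (hR : Function.Injective (sqrtCov γ))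
    {p : Lp ℝ 2 γ × Lp (RangeSpace (sqrtCov γ)) 2 γ}
    (hp : p ∈ (grossGraph (sqrtCov γ) γ).topologicalClosure) (h0 : p.1 = 0) : p.2 = 0 := by
  obtain ⟨f, g⟩ := p
  obtain ⟨g, rfl⟩ := (lpOfVecEquiv (sqrtCov γ) hR γ).surjective g
  have h := snd_eq_zero_of_mem_closure_rGraph hγ hR
    ((mem_closure_grossGraph_iff _ hR (adjoint_sqrtCov γ) γ f g).mp hp) h0
  simp only at h
  rw [h, map_zero]

theorem graph_malliavinM {γ : Measure H} [IsGaussian γ] (hγ : ∫ x, x ∂γ = 0)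
    (hR : Function.Injective (sqrtCov γ)) :
    (malliavinM γ).graph = (rGraph (sqrtCov γ) γ).topologicalClosure :=
  (isClosable_toLinearPMap fun _ => snd_eq_zero_of_mem_closure_rGraph hγ hR).2

theorem graph_grossMalliavin {γ : Measure H} [IsGaussian γ] (hγ : ∫ x, x ∂γ = 0)
    (hR : Function.Injective (sqrtCov γ)) :
    (grossMalliavin γ).graph = (grossGraph (sqrtCov γ) γ).topologicalClosure :=
  (isClosable_toLinearPMap fun _ => snd_eq_zero_of_mem_closure_grossGraph hγ hR).2

/-- Closed operators are compared through their graphs, which correspond under the isomorphism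
induced by `Q^{1/2}`. Equality of partial maps includes equality of domains, hence of the Sobolev
spaces. -/
theorem grossMalliavin_eq {γ : Measure H} [IsGaussian γ] (hγ : ∫ x, x ∂γ = 0)
    (hR : Function.Injective (sqrtCov γ)) :
    grossMalliavin γ =
      ((RangeSpace.ofVec (sqrtCov γ)).compLpL 2 γ :
        Lp H 2 γ →ₗ[ℝ] Lp (RangeSpace (sqrtCov γ)) 2 γ).compPMap (malliavinM γ) := by
  refine LinearPMap.eq_of_eq_graph (Submodule.ext ?_)
  rintro ⟨f, g⟩
  obtain ⟨g, rfl⟩ := (lpOfVecEquiv (sqrtCov γ) hR γ).surjective g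
  rw [graph_grossMalliavin hγ hR, mem_closure_grossGraph_iff _ hR (adjoint_sqrtCov γ),
    ← graph_malliavinM hγ hR, LinearPMap.mem_graph_iff, LinearPMap.mem_graph_iff]
  exact exists_congr fun y => and_congr_right fun _ =>
    (lpOfVecEquiv (sqrtCov γ) hR γ).injective.eq_iff.symm

theorem exists_malliavinM_eq {γ : Measure H} [IsGaussian γ] (hγ : ∫ x, x ∂γ = 0)
    (hR : Function.Injective (sqrtCov γ)) {φ : H → ℝ} (hφ : IsCb1 φ) :
    ∃ g : (malliavinM γ).domain, (g : Lp ℝ 2 γ) =ᵐ[γ] φ ∧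
      malliavinM γ g =ᵐ[γ] rGradient (sqrtCov γ) φ := by
  have h1 := (hφ.memLp (γ := γ)).coeFn_toLp
  have h2 := (hφ.memLp_rGradient (γ := γ) (sqrtCov γ)).coeFn_toLp
  have h : ((hφ.memLp (γ := γ)).toLp φ, (hφ.memLp_rGradient (sqrtCov γ)).toLp _) ∈
      (malliavinM γ).graph := by
    rw [graph_malliavinM hγ hR]
    exact Submodule.le_topologicalClosure _ ⟨φ, hφ, h1, h2⟩
  obtain ⟨g, hg, hg'⟩ := exists_apply_eq_of_mem_graph h
  exact ⟨g, by rw [hg]; exact h1, by rw [hg']; exact h2⟩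

theorem exists_graphNorm_eq {γ : Measure H} [IsGaussian γ] (hγ : ∫ x, x ∂γ = 0)
    (hR : Function.Injective (sqrtCov γ)) {φ : H → ℝ} (hφ : IsCb1 φ) :
    ∃ (f : (grossMalliavin γ).domain) (g : (malliavinM γ).domain),
      (f : Lp ℝ 2 γ) =ᵐ[γ] φ ∧ (g : Lp ℝ 2 γ) =ᵐ[γ] φ ∧
      grossMalliavin γ f =ᵐ[γ] grossGradient (sqrtCov γ) φ ∧
      malliavinM γ g =ᵐ[γ] rGradient (sqrtCov γ) φ ∧
      graphNorm (grossMalliavin γ) f = graphNorm (malliavinM γ) g := by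
  obtain ⟨g, hg, hg'⟩ := exists_malliavinM_eq hγ hR hφ
  rw [grossMalliavin_eq hγ hR]
  -- Composing with an everywhere defined map leaves the domain unchanged, so one element serves for
  -- both operators.
  refine ⟨g, g, hg, hg, ?_, hg', ?_⟩
  · refine (ContinuousLinearMap.coeFn_compLpL (RangeSpace.ofVec (sqrtCov γ))
      (malliavinM γ g)).trans ?_
    filter_upwards [hg'] with x hx
    rw [hx, hφ.grossGradient_eq_ofVec _ (adjoint_sqrtCov γ)]
  · have h := norm_lpOfVecEquiv (sqrtCov γ) hR γ (malliavinM γ g)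
    exact congrArg (fun t => √(‖(g : Lp ℝ 2 γ)‖ ^ 2 + t ^ 2)) h

theorem compLpL_incl_ofVec (R : H →L[ℝ] H) (γ : Measure H) (g : Lp H 2 γ) :
    (RangeSpace.incl R).compLpL 2 γ ((RangeSpace.ofVec R).compLpL 2 γ g) = R.compLpL 2 γ g := by
  refine Lp.ext ?_
  refine (ContinuousLinearMap.coeFn_compLpL _ _).trans ?_
  filter_upwards [ContinuousLinearMap.coeFn_compLpL (RangeSpace.ofVec R) g,
    ContinuousLinearMap.coeFn_compLpL R g] with x hx hx2
  rw [hx, hx2, RangeSpace.incl_ofVec]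

theorem incl_compPMap_grossMalliavin_eq_iff {γ : Measure H} [IsGaussian γ] (hγ : ∫ x, x ∂γ = 0)
    (hR : Function.Injective (sqrtCov γ)) :
    ((RangeSpace.incl (sqrtCov γ)).compLpL 2 γ :
      Lp (RangeSpace (sqrtCov γ)) 2 γ →ₗ[ℝ] Lp H 2 γ).compPMap (grossMalliavin γ) =
        malliavinM γ ↔ covarianceOperator γ = ContinuousLinearMap.id ℝ H := by
  -- Followed by the embedding into `H`, the Gross derivative becomes `Q^{1/2} M`.
  have hcomp : ((RangeSpace.incl (sqrtCov γ)).compLpL 2 γ :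
      Lp (RangeSpace (sqrtCov γ)) 2 γ →ₗ[ℝ] Lp H 2 γ).compPMap (grossMalliavin γ) =
        ((sqrtCov γ).compLpL 2 γ : Lp H 2 γ →ₗ[ℝ] Lp H 2 γ).compPMap (malliavinM γ) := by
    rw [grossMalliavin_eq hγ hR]
    exact LinearPMap.ext rfl fun g h1 h2 => compLpL_incl_ofVec _ _ _
  rw [hcomp, ← sqrtCov_eq_id_iff]
  constructor
  · intro h
    have hD : ∀ {φ : H → ℝ}, IsCb1 φ → ∀ᵐ x ∂γ,
        sqrtCov γ (rGradient (sqrtCov γ) φ x) = rGradient (sqrtCov γ) φ x := by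
      intro φ hφ
      obtain ⟨g, -, hg⟩ := exists_malliavinM_eq hγ hR hφ
      have h1 : (sqrtCov γ).compLpL 2 γ (malliavinM γ g) = malliavinM γ g :=
        (LinearPMap.ext_iff.mp h).2 (hf := g.2) (hg := g.2)
      have h2 := ContinuousLinearMap.coeFn_compLpL (sqrtCov γ) (malliavinM γ g)
      rw [h1] at h2
      filter_upwards [h2, hg] with x hx hx2
      rw [← hx2]
      exact hx.symm
    ext a
    -- `γ` is a probability measure, so some point satisfies both almost sure identities, and one
    -- point is enough.
    obtain ⟨x, hc, hs⟩ := ((hD (isCb1_cos_inner a)).and (hD (isCb1_sin_inner a))).exists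
    rw [rGradient_comp_inner Real.hasDerivAt_cos (isCb1_cos_inner a), adjoint_sqrtCov,
      map_smul] at hc
    rw [rGradient_comp_inner Real.hasDerivAt_sin (isCb1_sin_inner a), adjoint_sqrtCov,
      map_smul] at hs
    refine hR ?_
    -- Sine and cosine never vanish together, so one of the scalars can be cancelled.
    by_cases h0 : Real.cos ⟪a, x⟫ = 0
    · refine smul_right_injective H (r := -Real.sin ⟪a, x⟫) (fun h1 => ?_) hc
      have := Real.sin_sq_add_cos_sq ⟪a, x⟫
      rw [h0, neg_eq_zero.mp h1] at this
      norm_num at this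
    · exact smul_right_injective H h0 hs
  · intro h
    refine LinearPMap.ext rfl fun f h1 h2 => ?_
    refine Lp.ext ((ContinuousLinearMap.coeFn_compLpL (sqrtCov γ) (malliavinM γ ⟨f, h2⟩)).trans ?_)
    rw [h]
    rfl

end Malliavin

theorem mainTheorem1 {H : Type*} [NormedAddCommGroup H] [InnerProductSpace ℝ H] [CompleteSpace H]
    [SecondCountableTopology H] [MeasurableSpace H] [BorelSpace H]
    (γ : Measure H) [IsGaussian γ] (hcentered : ∫ x, x ∂γ = 0)
    (hnondeg : LinearMap.ker (covarianceOperator γ : H →ₗ[ℝ] H) = ⊥) :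
    -- on `C^1_b(H)` both gradients exist at every point, `∇_{H_{Q^{1/2}}} φ = Q^{1/2} ∇_{Q^{1/2}} φ`,
    -- and their norms (in `H_{Q^{1/2}}` and in `H`) agree
    (∀ φ : H → ℝ, Malliavin.IsCb1 φ → ∀ x : H,
      Malliavin.HasGrossGradientAt (Malliavin.sqrtCov γ) φ
        (Malliavin.grossGradient (Malliavin.sqrtCov γ) φ x) x ∧
      Malliavin.HasRGradientAt (Malliavin.sqrtCov γ) φ
        (Malliavin.rGradient (Malliavin.sqrtCov γ) φ x) x ∧
      Malliavin.grossGradient (Malliavin.sqrtCov γ) φ x =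
        Malliavin.RangeSpace.ofVec (Malliavin.sqrtCov γ)
          (Malliavin.rGradient (Malliavin.sqrtCov γ) φ x) ∧
      ‖Malliavin.grossGradient (Malliavin.sqrtCov γ) φ x‖ =
        ‖Malliavin.rGradient (Malliavin.sqrtCov γ) φ x‖) ∧
    -- the gradients are closable operators, so that their closures are well defined
    (Malliavin.grossOp (Malliavin.sqrtCov γ) γ).IsClosable ∧
    (Malliavin.rOp (Malliavin.sqrtCov γ) γ).IsClosable ∧
    -- `C^1_b(H)` is contained in both domains, the Malliavin derivatives extend the gradients,
    -- and the two graph norms agree on `C^1_b(H)`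
    (∀ φ : H → ℝ, Malliavin.IsCb1 φ →
      ∃ (f : (Malliavin.grossMalliavin γ).domain) (g : (Malliavin.malliavinM γ).domain),
        (f : Lp ℝ 2 γ) =ᵐ[γ] φ ∧ (g : Lp ℝ 2 γ) =ᵐ[γ] φ ∧
        Malliavin.grossMalliavin γ f =ᵐ[γ] Malliavin.grossGradient (Malliavin.sqrtCov γ) φ ∧
        Malliavin.malliavinM γ g =ᵐ[γ] Malliavin.rGradient (Malliavin.sqrtCov γ) φ ∧
        Malliavin.graphNorm (Malliavin.grossMalliavin γ) f =
          Malliavin.graphNorm (Malliavin.malliavinM γ) g) ∧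
    -- the Sobolev spaces coincide
    Malliavin.sobolevM γ = Malliavin.sobolevGross γ ∧
    -- `∇_{H_{Q^{1/2}}} = Q^{1/2} M`, as operators with values in `L²(H, γ; H_{Q^{1/2}})`
    Malliavin.grossMalliavin γ =
      ((Malliavin.RangeSpace.ofVec (Malliavin.sqrtCov γ)).compLpL 2 γ :
        Lp H 2 γ →ₗ[ℝ] Lp (Malliavin.RangeSpace (Malliavin.sqrtCov γ)) 2 γ).compPMap
        (Malliavin.malliavinM γ) ∧
    -- regarded as operators with values in `L²(H, γ; H)`, the two Malliavin derivatives coincide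
    -- only if `Q` is the identity, and they are different if `H` is infinite-dimensional
    (((Malliavin.RangeSpace.incl (Malliavin.sqrtCov γ)).compLpL 2 γ :
        Lp (Malliavin.RangeSpace (Malliavin.sqrtCov γ)) 2 γ →ₗ[ℝ] Lp H 2 γ).compPMap
        (Malliavin.grossMalliavin γ) = Malliavin.malliavinM γ ↔
      covarianceOperator γ = ContinuousLinearMap.id ℝ H) ∧
    (¬ FiniteDimensional ℝ H →
      ((Malliavin.RangeSpace.incl (Malliavin.sqrtCov γ)).compLpL 2 γ :
        Lp (Malliavin.RangeSpace (Malliavin.sqrtCov γ)) 2 γ →ₗ[ℝ] Lp H 2 γ).compPMap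
        (Malliavin.grossMalliavin γ) ≠ Malliavin.malliavinM γ) := by
  have hR := Malliavin.sqrtCov_injective hnondeg
  have hiff := Malliavin.incl_compPMap_grossMalliavin_eq_iff hcentered hR
  refine ⟨fun φ hφ x => ?_, ?_, ?_, fun φ hφ => Malliavin.exists_graphNorm_eq hcentered hR hφ, ?_,
    Malliavin.grossMalliavin_eq hcentered hR, hiff, fun hH h =>
      Malliavin.covarianceOperator_ne_id γ hH (hiff.mp h)⟩
  · have hG := hφ.grossGradient_eq_ofVec _ (Malliavin.adjoint_sqrtCov γ) x
    exact ⟨hφ.hasGrossGradientAt _ x, hφ.hasRGradientAt _ x, hG,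
      by rw [hG, Malliavin.norm_ofVec hR]⟩
  · exact (Malliavin.isClosable_toLinearPMap fun _ =>
      Malliavin.snd_eq_zero_of_mem_closure_grossGraph hcentered hR).1
  · exact (Malliavin.isClosable_toLinearPMap fun _ =>
      Malliavin.snd_eq_zero_of_mem_closure_rGraph hcentered hR).1
  · rw [Malliavin.sobolevM, Malliavin.sobolevGross, Malliavin.grossMalliavin_eq hcentered hR]
    rfl
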